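/- All graphs are finite, undirected, without loops or multiple edges. Let $G$ be a 2-connected graph of order $n$ (that is, $n\ge 3$ and $G$ stays connected after the deletion of any set of at most one vertex). Let $c$ be the circumference of $G$ (the number of vertices of a longest cycle), let $p$ be the number of vertices of a longest path in $G$, and let $\delta$ be the minimum degree of $G$. Then $$ c\ \ge\ B,\qquad\text{where}\qquad B=\begin{cases} p & \text{if } p\le 2\delta,\\ p-1 & \text{if } 2\delta+1\le p\le 3\delta-2,\\ \sqrt{2p-10+\left(\delta-\tfrac72\right)^2}+\delta+\tfrac12 & \text{if } p\ge 3\delta-1.\end{cases} $$ Consequently this is a common generalization of two bounds of Dirac: $c\ge\min\{n,2\delta\}$, and, strictly strengthening $c\ge\sqrt{2p}$, in each of the three ranges $B>\sqrt{2p}$. -/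

import Mathlib

namespace SimpleGraph

/-- A graph is `k`-connected if it has more than `k` vertices and deleting any set of fewer than
`k` vertices leaves a connected graph. -/
def IsVertexConnected {V : Type*} (G : SimpleGraph V) (k : ℕ) : Prop :=
  k < Nat.card V ∧ ∀ s : Finset V, s.card < k → (G.induce ((s : Set V)ᶜ)).Connected

/-- The circumference: the largest order of a cycle. The order of a cycle equals its length. On a
finite graph the set of these orders is bounded, so for a graph with a cycle this is a maximum. -/
noncomputable def circumference {V : Type*} (G : SimpleGraph V) : ℕ :=
  sSup {k : ℕ | ∃ (v : V) (w : G.Walk v v), w.IsCycle ∧ w.length = k}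

/-- The order (number of vertices) of a longest path; a path of length `l` has `l + 1` vertices.
On a finite nonempty graph this is a maximum. -/
noncomputable def longestPathOrder {V : Type*} (G : SimpleGraph V) : ℕ :=
  sSup {k : ℕ | ∃ (u v : V) (w : G.Walk u v), w.IsPath ∧ w.length + 1 = k}

end SimpleGraph

/-!
Among the pairs of a longest path and a cycle closed up from an initial segment of it, take one
whose cycle `C` is longest, and let `R` be the rest of the path. If `R` is nonempty and
`|C| < 2δ`, then by Ore's crossing argument every vertex of `C` except the one attached to `R`
starts a path through `C` and then `R`. The neighbours of such a vertex lie on this longest path,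
and by the choice of `C` they even lie on `C`, so that the attaching vertex is a cut vertex. Hence
`R` is empty, and `C` spans the graph by connectivity, or `2δ ≤ |C|`. If `R` has at least two
vertices, then distinct neighbours on `C` of the two ends of `R` are more than `|R|` steps apart,
and counting the gaps between them gives `3δ ≤ p + 1`; otherwise `p ≤ c + 1`.

For the third range, cover a longest path by Dirac's vine of `m` overlapping members, each reaching
as far as possible. Any two members `i < j` lie on a cycle that also contains the parts of the path
left uncovered between them, and adding up the cycles of nested pairs around the middle gives
`4p + (m + 1)² ≤ 2(m + 1)c + 5`. When `m ≥ 3`, the outermost members can be moved to other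
neighbours of the ends of the path so that the cycle through all members contains almost all
neighbours of both ends, whence `2δ + m ≤ c + 2`. The first bound increases with `m`, and at
`m = c + 2 - 2δ` it is the square root bound up to `(c - 2δ - 1)²` and a parity argument.
-/

namespace CircumferenceBound

open SimpleGraph

section Lists

variable {V : Type*} {G : SimpleGraph V}

/-- The vertex list of a path of `G`; unlike a walk it carries no endpoints in its type, so paths
can be cut and reassembled with list operations. The empty list is allowed. -/
structure IsPathList (G : SimpleGraph V) (l : List V) : Prop where
  isChain : l.IsChain G.Adj
  nodup : l.Nodup

/-- The vertex list of a cycle of `G`, listed from an arbitrary vertex and without repeating that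
vertex at the end. -/
structure IsCycleList (G : SimpleGraph V) (l : List V) : Prop extends IsPathList G l where
  three_le_length : 3 ≤ l.length
  adj : ∀ x ∈ l.getLast?, ∀ y ∈ l.head?, G.Adj x y

theorem isChain_adj_reverse {l : List V} : l.reverse.IsChain G.Adj ↔ l.IsChain G.Adj := by
  simp only [List.isChain_reverse, G.adj_comm]

theorem IsPathList.reverse {l : List V} (h : IsPathList G l) : IsPathList G l.reverse :=
  ⟨isChain_adj_reverse.2 h.isChain, List.nodup_reverse.2 h.nodup⟩

theorem IsPathList.infix {l l' : List V} (h : IsPathList G l) (hl : l' <:+: l) :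
    IsPathList G l' :=
  ⟨h.isChain.infix hl, h.nodup.sublist hl.sublist⟩

theorem IsCycleList.append_comm {a b : List V} (h : IsCycleList G (a ++ b)) :
    IsCycleList G (b ++ a) := by
  rcases eq_or_ne a [] with rfl | ha
  · simpa using h
  rcases eq_or_ne b [] with rfl | hb
  · simpa using h
  obtain ⟨hca, hcb, hab⟩ := List.isChain_append.1 h.isChain
  have hba := h.adj
  rw [List.getLast?_append_of_ne_nil _ hb, List.head?_append_of_ne_nil _ ha] at hba
  refine ⟨⟨List.isChain_append.2 ⟨hcb, hca, hba⟩, (List.perm_append_comm.nodup_iff).1 h.nodup⟩,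
    by simpa [add_comm] using h.three_le_length, ?_⟩
  rwa [List.getLast?_append_of_ne_nil _ ha, List.head?_append_of_ne_nil _ hb]

theorem IsCycleList.rotate {l : List V} (h : IsCycleList G l) (n : ℕ) :
    IsCycleList G (l.rotate n) := by
  rw [List.rotate_eq_drop_append_take_mod]
  exact IsCycleList.append_comm (by rwa [List.take_append_drop])

theorem IsPathList.exists_walk {l : List V} (h : IsPathList G l) (hl : l ≠ []) :
    ∃ w : G.Walk (l.head hl) (l.getLast hl), w.IsPath ∧ w.support = l :=
  ⟨.ofSupport l hl h.isChain, (Walk.isPath_def _).2 (by simpa using h.nodup),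
    Walk.support_ofSupport ..⟩

section Finite

variable [Finite V]

theorem bddAbove_pathOrders :
    BddAbove {k : ℕ | ∃ (u v : V) (w : G.Walk u v), w.IsPath ∧ w.length + 1 = k} := by
  have := Fintype.ofFinite V
  refine ⟨Fintype.card V, ?_⟩
  rintro _ ⟨u, v, w, hw, rfl⟩
  exact hw.length_lt

theorem bddAbove_cycleLengths :
    BddAbove {k : ℕ | ∃ (v : V) (w : G.Walk v v), w.IsCycle ∧ w.length = k} := by
  have := Fintype.ofFinite V
  refine ⟨Fintype.card V, ?_⟩
  rintro _ ⟨v, w, hw, rfl⟩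
  simpa using hw.support_nodup.length_le_card

theorem IsPathList.length_le_longestPathOrder {l : List V} (h : IsPathList G l) :
    l.length ≤ G.longestPathOrder := by
  rcases eq_or_ne l [] with rfl | hl
  · simp
  obtain ⟨w, hw, hs⟩ := h.exists_walk hl
  exact le_csSup bddAbove_pathOrders ⟨_, _, w, hw, by rw [← Walk.length_support, hs]⟩

theorem exists_isPathList_length_eq [Nonempty V] :
    ∃ l, IsPathList G l ∧ l.length = G.longestPathOrder := by
  have hne : {k : ℕ | ∃ (u v : V) (w : G.Walk u v), w.IsPath ∧ w.length + 1 = k}.Nonempty :=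
    ⟨1, Classical.arbitrary V, _, Walk.nil, by simp⟩
  obtain ⟨u, v, w, hw, hk⟩ := Nat.sSup_mem hne bddAbove_pathOrders
  exact ⟨w.support, ⟨w.isChain_adj_support, hw.support_nodup⟩, by rwa [Walk.length_support]⟩

theorem IsCycleList.length_le_circumference {l : List V} (h : IsCycleList G l) :
    l.length ≤ G.circumference := by
  have h3 := h.three_le_length
  have hl : l ≠ [] := List.ne_nil_of_length_pos (by lia)
  obtain ⟨w, hw, hs⟩ := h.exists_walk hl
  have hadj : G.Adj (l.getLast hl) (l.head hl) :=
    h.adj _ (List.getLast?_eq_some_getLast hl) _ (List.head?_eq_some_head hl)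
  have hlen : w.length + 1 = l.length := by rw [← Walk.length_support, hs]
  refine le_csSup bddAbove_cycleLengths ⟨_, .cons hadj w, ?_, by simpa using hlen⟩
  refine Walk.cons_isCycle_iff w hadj |>.2 ⟨hw, fun hmem ↦ ?_⟩
  have := hw.length_eq_one_of_mem_edges (Sym2.eq_swap ▸ hmem)
  lia

end Finite

theorem IsPathList.mem_of_adj_head {x y : V} {l : List V} (h : IsPathList G (x :: l))
    (hmax : ∀ l', IsPathList G l' → l'.length ≤ (x :: l).length) (hxy : G.Adj x y) : y ∈ l := by
  by_contra hy
  have hlen := hmax (y :: x :: l) ⟨List.isChain_cons_cons.2 ⟨hxy.symm, h.isChain⟩,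
    List.nodup_cons.2 ⟨by simp [hxy.ne', hy], h.nodup⟩⟩
  simp at hlen

end Lists

section Connectivity

variable {V : Type*} {G : SimpleGraph V}

theorem exists_adj_of_isVertexConnected (hG : G.IsVertexConnected 2) (a : V) (S : Set V)
    {x y : V} (hx : x ∈ S) (hxa : x ≠ a) (hy : y ∉ S) (hya : y ≠ a) :
    ∃ u ∈ S, ∃ v ∉ S, u ≠ a ∧ v ≠ a ∧ G.Adj u v := by
  obtain ⟨w⟩ := (hG.2 {a} (by simp)).preconnected ⟨x, by simpa using hxa⟩ ⟨y, by simpa using hya⟩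
  obtain ⟨d, -, hd, hd'⟩ := w.exists_boundary_dart (Subtype.val ⁻¹' S) hx hy
  exact ⟨d.fst, hd, d.snd, hd', by simpa using d.fst.2, by simpa using d.snd.2, d.adj⟩

theorem two_le_degree_of_isVertexConnected (hG : G.IsVertexConnected 2) (v : V)
    [Fintype (G.neighborSet v)] : 2 ≤ G.degree v := by
  classical
  obtain ⟨-, _⟩ := Nat.card_pos_iff.1 (Nat.zero_lt_of_lt hG.1)
  have := Fintype.ofFinite V
  by_contra! hlt
  rw [← card_neighborFinset_eq_degree] at hlt
  obtain ⟨y, -, hy⟩ : ∃ y ∈ Finset.univ, y ∉ insert v (G.neighborFinset v) := by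
    refine Finset.exists_mem_notMem_of_card_lt_card ((Finset.card_insert_le _ _).trans_lt ?_)
    have hcard := hG.1
    rw [Nat.card_eq_fintype_card] at hcard
    rw [Finset.card_univ]
    lia
  simp only [Finset.mem_insert, mem_neighborFinset, not_or] at hy
  obtain ⟨w⟩ := (hG.2 _ hlt).preconnected ⟨v, by simp⟩ ⟨y, by simpa using hy.2⟩
  obtain ⟨d, -, hd, -⟩ := w.exists_boundary_dart {⟨v, by simp⟩} rfl (by simpa using hy.1)
  have hfst : (d.fst : V) = v := congrArg Subtype.val hd
  exact d.snd.2 (by simpa [hfst] using d.adj)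

end Connectivity

section Lollipops

variable {V : Type*} {G : SimpleGraph V}

/-- A cycle `C` with a path `R` attached: `C` is listed so that its last vertex is joined to the
first vertex of `R`, which makes `C ++ R` a path. The tail `R` may be empty. -/
structure IsLollipop (G : SimpleGraph V) (C R : List V) : Prop where
  isPathList : IsPathList G (C ++ R)
  isCycleList : IsCycleList G C

/-- A lollipop spanning a longest path, with its cycle as long as possible. -/
structure IsMaxLollipop (G : SimpleGraph V) (C R : List V) : Prop extends IsLollipop G C R where
  length_le : ∀ l, IsPathList G l → l.length ≤ (C ++ R).length
  cycle_length_le : ∀ C' R', IsLollipop G C' R' → (C' ++ R').length = (C ++ R).length →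
    C'.length ≤ C.length

theorem exists_isLollipop [Nonempty V] [G.LocallyFinite] (hdeg : ∀ v, 2 ≤ G.degree v) {l : List V}
    (hl : IsPathList G l) (hmax : ∀ l', IsPathList G l' → l'.length ≤ l.length) :
    ∃ C R, IsLollipop G C R ∧ C ++ R = l := by
  classical
  obtain _ | ⟨x, l⟩ := l
  · simpa using hmax [Classical.arbitrary V] ⟨by simp, by simp⟩
  obtain ⟨z, hxz, hz⟩ : ∃ z ∈ G.neighborFinset x, z ≠ l.headD x :=
    Finset.exists_mem_ne (by rw [card_neighborFinset_eq_degree]; exact hdeg x) _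
  rw [mem_neighborFinset] at hxz
  obtain ⟨l₁, l₂, rfl⟩ := List.append_of_mem (hl.mem_of_adj_head hmax hxz)
  have hl₁ : l₁ ≠ [] := by rintro rfl; simp at hz
  refine ⟨x :: l₁ ++ [z], l₂, ⟨by simpa using hl, hl.infix ⟨[], l₂, by simp⟩, ?_, ?_⟩, by simp⟩
  · have := List.length_pos_of_ne_nil hl₁
    simp only [List.length_append, List.length_cons, List.length_nil]
    lia
  · rw [List.getLast?_concat]
    simpa using hxz.symm

theorem exists_isMaxLollipop [Finite V] [Nonempty V] [G.LocallyFinite]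
    (hdeg : ∀ v, 2 ≤ G.degree v) :
    ∃ C R, IsMaxLollipop G C R ∧ (C ++ R).length = G.longestPathOrder := by
  obtain ⟨l, hl, hlen⟩ := exists_isPathList_length_eq (G := G)
  have hmax l' (h : IsPathList G l') : l'.length ≤ l.length :=
    hlen ▸ h.length_le_longestPathOrder
  let cycleLengths : Set ℕ :=
    {k | ∃ C R, IsLollipop G C R ∧ (C ++ R).length = l.length ∧ C.length = k}
  have hne : cycleLengths.Nonempty := by
    obtain ⟨C, R, h, rfl⟩ := exists_isLollipop hdeg hl hmax
    exact ⟨_, C, R, h, rfl, rfl⟩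
  have hbdd : BddAbove cycleLengths := by
    refine ⟨l.length, ?_⟩
    rintro _ ⟨C, R, -, hCR, rfl⟩
    simp [← hCR]
  obtain ⟨C, R, hCR, hCRlen, hC⟩ := Nat.sSup_mem hne hbdd
  refine ⟨C, R, ⟨hCR, fun l' h ↦ (hmax l' h).trans hCRlen.ge, fun C' R' h hlen' ↦ ?_⟩,
    hCRlen.trans hlen⟩
  exact hC ▸ le_csSup hbdd ⟨C', R', h, hlen'.trans hCRlen, rfl⟩

theorem IsMaxLollipop.length_le_of_perm {C R C' R' : List V} (h : IsMaxLollipop G C R)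
    (hperm : (C' ++ R').Perm (C ++ R)) (hchain : (C' ++ R').IsChain G.Adj)
    (hadj : ∀ x ∈ C'.getLast?, ∀ y ∈ C'.head?, G.Adj x y) : C'.length ≤ C.length := by
  by_contra! hlt
  have hpath : IsPathList G (C' ++ R') := ⟨hchain, hperm.nodup_iff.2 h.isPathList.nodup⟩
  refine hlt.not_ge (h.cycle_length_le C' R' ⟨hpath, hpath.infix ⟨[], R', by simp⟩, ?_, hadj⟩
    hperm.length_eq)
  exact h.isCycleList.three_le_length.trans hlt.le

theorem IsMaxLollipop.of_perm {C R C' R' : List V} (h : IsMaxLollipop G C R)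
    (hC' : IsCycleList G C') (hC : C'.Perm C) (hR : R'.Perm R)
    (hchain : (C' ++ R').IsChain G.Adj) : IsMaxLollipop G C' R' := by
  have hperm := hC.append hR
  refine ⟨⟨⟨hchain, hperm.nodup_iff.2 h.isPathList.nodup⟩, hC'⟩, ?_, ?_⟩
  · rw [hperm.length_eq]
    exact h.length_le
  · rw [hperm.length_eq, hC.length_eq]
    exact h.cycle_length_le

end Lollipops

section SpanningStarts

variable {V : Type*} {G : SimpleGraph V}

/-- The vertex `e` of the lollipop `(C, R)` starts a path that runs through all of `C` and then
through `R`. -/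
def IsSpanningStart (G : SimpleGraph V) (C R : List V) (e : V) : Prop :=
  ∃ C', (e :: C').Perm C ∧ (e :: C' ++ R).IsChain G.Adj

theorem IsMaxLollipop.mem_of_adj {C R : List V} {e z : V} (h : IsMaxLollipop G C R)
    (he : IsSpanningStart G C R e) (hez : G.Adj e z) : z ∈ C := by
  obtain ⟨C', hC', hchain⟩ := he
  have hperm := hC'.append_right R
  have hpath : IsPathList G (e :: C' ++ R) := ⟨hchain, hperm.nodup_iff.2 h.isPathList.nodup⟩
  have hz : z ∈ C' ++ R :=
    hpath.mem_of_adj_head (fun l hl ↦ (h.length_le l hl).trans hperm.length_eq.ge) hez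
  refine (List.mem_append.1 hz).elim (fun hz ↦ hC'.subset (List.mem_cons_of_mem e hz))
    fun hz ↦ ?_
  obtain ⟨R₁, R₂, rfl⟩ := List.append_of_mem hz
  have hlen := h.length_le_of_perm (C' := e :: C' ++ R₁ ++ [z]) (R' := R₂) (by simpa using hperm)
    (by simpa using hchain) (by
      rw [List.getLast?_concat]
      simpa using hez.symm)
  simp [← hC'.length_eq] at hlen

theorem exists_consecutive_of_length_lt {α : Type*} (P Q : α → Bool) :
    ∀ l : List α, l.length < l.countP P + l.tail.countP Q →
      ∃ a u w b, l = a ++ u :: w :: b ∧ P u ∧ Q w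
  | [], h => by simp at h
  | [u], h => by
    have := List.countP_le_length (p := P) (l := [u])
    simp only [List.tail_cons, List.countP_nil] at h
    lia
  | u :: w :: b, h => by
    by_cases huw : P u ∧ Q w
    · exact ⟨[], u, w, b, rfl, huw⟩
    obtain ⟨a, u', w', b', hl, huw'⟩ := exists_consecutive_of_length_lt P Q (w :: b) (by
      simp only [List.tail_cons, List.length_cons, List.countP_cons (l := w :: b),
        List.countP_cons (a := w) (p := Q)] at h ⊢
      split_ifs at h <;> simp_all <;> lia)
    exact ⟨u :: a, u', w', b', by simp [hl], huw'⟩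

theorem degree_le_countP [DecidableRel G.Adj] {x : V} [Fintype (G.neighborSet x)] {l : List V}
    (h : ∀ y, G.Adj x y → y ∈ l) : G.degree x ≤ l.countP (fun y ↦ G.Adj x y) := by
  classical
  rw [← card_neighborFinset_eq_degree, List.countP_eq_length_filter]
  refine (Finset.card_le_card fun y hy ↦ ?_).trans (List.toFinset_card_le _)
  rw [mem_neighborFinset] at hy
  simp [hy, h y hy]

theorem exists_perm_of_crossing {a b S : List V} {u w : V} (hS₀ : S ≠ [])
    (hP : (a ++ u :: w :: b).IsChain G.Adj) (hS : S.IsChain G.Adj)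
    (hw : ∀ x ∈ (a ++ [u]).head?, G.Adj x w) (hu : ∀ y ∈ S.head?, G.Adj u y) :
    ∃ L : List V, L.Perm (a ++ u :: w :: b ++ S) ∧ L.IsChain G.Adj ∧
      L.head? = (a ++ u :: w :: b).getLast? ∧ L.getLast? = S.getLast? := by
  refine ⟨(w :: b).reverse ++ (a ++ [u] ++ S), ?_, ?_, ?_, ?_⟩
  · classical
    rw [List.perm_iff_count]
    intro z
    simp only [List.count_append, List.count_cons, List.count_reverse, List.count_nil]
    lia
  · rw [List.isChain_append, isChain_adj_reverse, List.isChain_append]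
    refine ⟨hP.infix ⟨a ++ [u], [], by simp⟩, ⟨hP.infix ⟨[], w :: b, by simp⟩, hS, ?_⟩, ?_⟩
    · simpa using hu
    · intro x hx y hy
      rw [List.head?_append_of_ne_nil _ (by simp)] at hy
      obtain rfl : w = x := by simpa using hx
      exact (hw y hy).symm
  · simp [List.getLast?_append, List.getLast?_cons]
  · rw [← List.append_assoc, List.getLast?_append_of_ne_nil _ hS₀]

/-- Ore's crossing argument: if neither path had two consecutive vertices joined crosswise to `x`
and `y`, the two degrees would add up to at most the number of vertices. -/
theorem exists_perm_of_length_lt_degree_add {x y : V} [Fintype (G.neighborSet x)]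
    [Fintype (G.neighborSet y)] {S T : List V} (hS : (x :: S).IsChain G.Adj)
    (hT : (y :: T).IsChain G.Adj) (hx : ∀ z, G.Adj x z → z ∈ x :: S ++ y :: T)
    (hy : ∀ z, G.Adj y z → z ∈ x :: S ++ y :: T)
    (hdeg : (x :: S ++ y :: T).length < G.degree x + G.degree y) :
    ∃ L : List V, L.Perm (x :: S ++ y :: T) ∧ L.IsChain G.Adj ∧ L.head? = (x :: S).getLast? ∧
      L.getLast? = (y :: T).getLast? := by
  classical
  have hx' := degree_le_countP hx
  have hy' := degree_le_countP hy
  have hcount : (x :: S).length <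
        (x :: S).countP (fun z ↦ G.Adj y z) + S.countP (fun z ↦ G.Adj x z) ∨
      (y :: T).length < (y :: T).countP (fun z ↦ G.Adj x z) + T.countP (fun z ↦ G.Adj y z) := by
    simp only [List.countP_append, List.countP_cons, List.length_append, SimpleGraph.irrefl,
      decide_false] at *
    lia
  rcases hcount with hcount | hcount
  · obtain ⟨a, u, w, b, hl, hu, hw⟩ := exists_consecutive_of_length_lt _ _ _ hcount
    rw [hl]
    refine exists_perm_of_crossing (by simp) (hl ▸ hS) hT ?_
      (by simpa using (of_decide_eq_true hu).symm)
    have hhead : (a ++ [u]).head? = some x := by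
      simpa [List.head?_append] using (congrArg List.head? hl).symm
    simpa [hhead] using hw
  · obtain ⟨a, u, w, b, hl, hu, hw⟩ := exists_consecutive_of_length_lt _ _ _ hcount
    obtain ⟨L, hL, hLc, hhead, hlast⟩ := exists_perm_of_crossing (S := x :: S) (by simp) (hl ▸ hT)
      hS (fun z hz ↦ by
        have hhead : (a ++ [u]).head? = some y := by
          simpa [List.head?_append] using (congrArg List.head? hl).symm
        simp_all) (by simpa using (of_decide_eq_true hu).symm)
    rw [← hl] at hL hhead
    exact ⟨L.reverse, L.reverse_perm.trans (hL.trans List.perm_append_comm),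
      isChain_adj_reverse.2 hLc, by simpa using hlast, by simpa using hhead⟩

theorem IsLollipop.isSpanningStart_of_append {S R : List V} {e a : V}
    (h : IsLollipop G (S ++ [e, a]) R) : IsSpanningStart G (S ++ [e, a]) R e := by
  have hperm : (e :: (S.reverse ++ [a])).Perm (S ++ [e, a]) := by
    simpa using (S ++ [e]).reverse_perm.append_right [a]
  refine ⟨S.reverse ++ [a], hperm, ?_⟩
  have hchain := h.isPathList.isChain
  have hrev : e :: (S.reverse ++ [a]) ++ R = (S ++ [e]).reverse ++ a :: R := by simp
  rw [hrev, List.isChain_append, isChain_adj_reverse]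
  refine ⟨hchain.infix ⟨[], a :: R, by simp⟩, hchain.infix ⟨S ++ [e], [], by simp⟩, ?_⟩
  have hadj := h.isCycleList.adj
  rw [List.append_cons, List.getLast?_concat, List.head?_append_of_ne_nil _ (by simp)] at hadj
  rw [List.getLast?_reverse]
  exact fun x hx y hy ↦ (hadj y hy x hx).symm

theorem IsMaxLollipop.isSpanningStart_of_append {S T R : List V} {e y : V}
    [G.LocallyFinite] {δ : ℕ} (hδ : ∀ v, δ ≤ G.degree v)
    (h : IsMaxLollipop G (S ++ e :: y :: T) R) (hlt : (S ++ e :: y :: T).length < 2 * δ)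
    (hy : IsSpanningStart G (S ++ e :: y :: T) R y) :
    IsSpanningStart G (S ++ e :: y :: T) R e := by
  obtain ⟨x, S', hS'⟩ : ∃ x S', S ++ [e] = x :: S' := List.exists_cons_of_ne_nil (by simp)
  have hsplit : S ++ e :: y :: T = x :: S' ++ y :: T := by simp [← hS']
  have hlast : (x :: S').getLast? = some e := by rw [← hS', List.getLast?_concat]
  rw [hsplit] at h hlt hy ⊢
  obtain ⟨hC, hR, hCR⟩ := List.isChain_append.1 h.isPathList.isChain
  have hx : IsSpanningStart G (x :: S' ++ y :: T) R x :=
    ⟨S' ++ y :: T, List.Perm.refl _, h.isPathList.isChain⟩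
  obtain ⟨L, hL, hLc, hhead, hlastL⟩ := exists_perm_of_length_lt_degree_add
    (hC.infix ⟨[], y :: T, by simp⟩) (hC.infix ⟨x :: S', [], by simp⟩)
    (fun z hz ↦ h.mem_of_adj hx hz) (fun z hz ↦ h.mem_of_adj hy hz)
    (by have := hδ x; have := hδ y; lia)
  obtain ⟨L', rfl⟩ : ∃ L', L = e :: L' := List.head?_eq_some_iff.1 (hhead.trans hlast)
  refine ⟨L', hL, List.isChain_append.2 ⟨hLc, hR, ?_⟩⟩
  rwa [hlastL, ← List.getLast?_append_of_ne_nil (x :: S') (by simp)]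

theorem IsMaxLollipop.isSpanningStart_of_ne_getLast [G.LocallyFinite] {δ : ℕ}
    (hδ : ∀ v, δ ≤ G.degree v) {R : List V} {a : V} :
    ∀ (T S : List V) (e : V), IsMaxLollipop G (S ++ e :: (T ++ [a])) R →
      (S ++ e :: (T ++ [a])).length < 2 * δ → IsSpanningStart G (S ++ e :: (T ++ [a])) R e
  | [], _, _, h, _ => h.toIsLollipop.isSpanningStart_of_append
  | y :: T, S, e, h, hlt => by
    have hsplit : S ++ e :: (y :: T ++ [a]) = (S ++ [e]) ++ y :: (T ++ [a]) := by simp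
    have hy := isSpanningStart_of_ne_getLast hδ T (S ++ [e]) y (hsplit ▸ h) (hsplit ▸ hlt)
    rw [← hsplit] at hy
    exact h.isSpanningStart_of_append hδ hlt hy

theorem IsMaxLollipop.two_mul_le_length [G.LocallyFinite] (hG : G.IsVertexConnected 2) {δ : ℕ}
    (hδ : ∀ v, δ ≤ G.degree v) {C R : List V} (h : IsMaxLollipop G C R) (hR : R ≠ []) :
    2 * δ ≤ C.length := by
  by_contra! hlt
  have h3 := h.isCycleList.three_le_length
  obtain ⟨C, a, rfl⟩ := (List.eq_nil_or_concat' C).resolve_left (by rintro rfl; simp at h3)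
  obtain ⟨x, C', rfl⟩ := List.exists_cons_of_ne_nil (l := C) (by rintro rfl; simp at h3)
  obtain ⟨y, R', rfl⟩ := List.exists_cons_of_ne_nil hR
  have hnodup := h.isPathList.nodup
  obtain ⟨u, hu, w, hw, hua, -, huw⟩ := exists_adj_of_isVertexConnected hG a
    {z | z ∈ x :: C' ++ [a]} (x := x) (y := y) (by simp) (by grind) (by grind) (by grind)
  have hu' : u ∈ x :: C' := by simpa [hua] using hu
  obtain ⟨S, T, hST⟩ := List.append_of_mem hu'
  refine hw (h.mem_of_adj ?_ huw)
  rw [hST, List.append_assoc, List.cons_append] at h hlt ⊢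
  exact h.isSpanningStart_of_ne_getLast hδ T S u hlt

end SpanningStarts

section CyclicGaps

open Finset

variable {K : ℕ} [NeZero K] {A B T : Finset (ZMod K)} {r : ℕ}

/-- Going forward around the cycle `ZMod K`, every point of `A` is more than `r` steps away from
every other point of `B`. -/
def Separated (r : ℕ) (A B : Finset (ZMod K)) : Prop :=
  ∀ a ∈ A, ∀ b ∈ B, a ≠ b → r < (b - a).val

/-- The points of `T` that are followed by a gap of more than `r` steps before the next point of
`T`, going forward around the cycle `ZMod K`. -/
def gapStarts (r : ℕ) (T : Finset (ZMod K)) : Finset (ZMod K) :=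
  {a ∈ T | ∀ b ∈ T, b ≠ a → r < (b - a).val}

/-- The gaps after distinct points are disjoint: the pairs `(a, d)` with `d < g a` inject into
`ZMod K` by `(a, d) ↦ a + d`. -/
theorem sum_le_of_forall_le_val_sub {g : ZMod K → ℕ} (hT : T.Nontrivial)
    (hg : ∀ a ∈ T, ∀ b ∈ T, a ≠ b → g a ≤ (b - a).val) : ∑ a ∈ T, g a ≤ K := by
  have heq {x y : ZMod K} {d e : ℕ} (hx : x ∈ T) (hy : y ∈ T) (hd : d < g x) (hed : e ≤ d)
      (hxy : x + d = y + e) : x = y := by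
    by_contra! hne
    have hlt := hd.trans_le (hg x hx y hy hne)
    have hsub : y - x = (d - e : ℕ) := by
      rw [Nat.cast_sub hed]
      linear_combination -hxy
    rw [hsub, ZMod.val_natCast] at hlt
    have := Nat.mod_le (d - e) K
    lia
  have hgK {x : ZMod K} (hx : x ∈ T) : g x < K := by
    obtain ⟨y, hy, hyx⟩ := hT.exists_ne x
    exact (hg x hx y hy hyx.symm).trans_lt (ZMod.val_lt _)
  have hinj : Set.InjOn (fun p : (_ : ZMod K) × ℕ ↦ p.1 + p.2) (T.sigma fun a ↦ range (g a)) := by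
    rintro ⟨x, d⟩ hx ⟨y, e⟩ hy hxy
    simp only [coe_sigma, Set.mem_sigma_iff, mem_coe, mem_range] at hx hy hxy
    obtain rfl : x = y := by
      rcases le_total e d with h | h
      · exact heq hx.1 hy.1 hx.2 h hxy
      · exact (heq hy.1 hx.1 hy.2 h hxy.symm).symm
    have := congrArg ZMod.val (add_left_cancel hxy)
    rw [ZMod.val_cast_of_lt (hx.2.trans (hgK hx.1)), ZMod.val_cast_of_lt (hy.2.trans (hgK hx.1))]
      at this
    rw [this]
  calc ∑ a ∈ T, g a = #(T.sigma fun a ↦ range (g a)) := by simp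
    _ ≤ #(univ : Finset (ZMod K)) := card_le_card_of_injOn _ (by simp) hinj
    _ = K := by rw [card_univ, ZMod.card]

theorem Separated.exists_mem_gapStarts (h : Separated r A B) (hAB : ∃ a ∈ A, ∃ b ∈ B, a ≠ b) :
    ∃ a ∈ A, a ∈ gapStarts r (A ∪ B) := by
  obtain ⟨a₀, ha₀, b₀, hb₀, hne₀⟩ := hAB
  obtain ⟨⟨a, b⟩, hab, hmin⟩ := exists_min_image {p ∈ A ×ˢ B | p.1 ≠ p.2} (fun p ↦ (p.2 - p.1).val)
    ⟨(a₀, b₀), by simp [ha₀, hb₀, hne₀]⟩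
  simp only [mem_filter, mem_product, and_imp, Prod.forall] at hab hmin
  obtain ⟨⟨ha, hb⟩, hne⟩ := hab
  refine ⟨a, ha, mem_filter.2 ⟨mem_union_left _ ha, fun c hc hca ↦ ?_⟩⟩
  rcases mem_union.1 hc with hc | hc
  · by_contra! hle
    have hlt := hle.trans_lt (h a ha b hb hne)
    have hcb : c ≠ b := by
      rintro rfl
      exact hlt.false
    have hval : (b - c).val = (b - a).val - (c - a).val := by
      rw [← ZMod.val_sub hlt.le, sub_sub_sub_cancel_right]
    have hpos : 0 < (c - a).val := by
      rwa [Nat.pos_iff_ne_zero, Ne, ZMod.val_eq_zero, sub_eq_zero]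
    have := hmin c b hc hb hcb
    lia
  · exact h a ha c hc hca.symm

theorem inter_subset_gapStarts (hAB : Separated r A B) (hBA : Separated r B A) :
    A ∩ B ⊆ gapStarts r (A ∪ B) := by
  intro a ha
  obtain ⟨haA, haB⟩ := mem_inter.1 ha
  refine mem_filter.2 ⟨mem_union_left _ haA, fun c hc hca ↦ ?_⟩
  exact (mem_union.1 hc).elim (hBA a haB c · hca.symm) (hAB a haA c · hca.symm)

theorem two_le_card_gapStarts (hA : A.Nontrivial) (hB : B.Nonempty) (hAB : Separated r A B)
    (hBA : Separated r B A) : 2 ≤ #(gapStarts r (A ∪ B)) := by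
  refine one_lt_card.2 ?_
  rcases (A ∩ B).eq_empty_or_nonempty with hI | ⟨z, hz⟩
  · have hdisj : ∀ a ∈ A, ∀ b ∈ B, a ≠ b := by
      rintro a ha _ hb rfl
      exact notMem_empty a (hI ▸ mem_inter.2 ⟨ha, hb⟩)
    obtain ⟨a₀, ha₀⟩ := hA.nonempty
    obtain ⟨b₀, hb₀⟩ := hB
    obtain ⟨a, ha, haT⟩ := hAB.exists_mem_gapStarts ⟨a₀, ha₀, b₀, hb₀, hdisj a₀ ha₀ b₀ hb₀⟩
    obtain ⟨b, hb, hbT⟩ :=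
      hBA.exists_mem_gapStarts ⟨b₀, hb₀, a₀, ha₀, (hdisj a₀ ha₀ b₀ hb₀).symm⟩
    exact ⟨a, haT, b, union_comm A B ▸ hbT, hdisj a ha b hb⟩
  · obtain ⟨hzA, hzB⟩ := mem_inter.1 hz
    have hsep : Separated r ((A ∪ B).erase z) {z} := by
      intro a ha b hb hab
      obtain rfl := mem_singleton.1 hb
      exact (mem_union.1 (mem_of_mem_erase ha)).elim (hAB a · b hzB hab) (hBA a · b hzA hab)
    obtain ⟨a, ha, haz⟩ := hA.exists_ne z
    obtain ⟨b, hb, hbT⟩ := hsep.exists_mem_gapStarts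
      ⟨a, mem_erase.2 ⟨haz, mem_union_left _ ha⟩, z, mem_singleton_self z, haz⟩
    rw [union_comm, ← insert_eq, insert_erase (mem_union_left _ hzA)] at hbT
    exact ⟨z, inter_subset_gapStarts hAB hBA hz, b, hbT, (ne_of_mem_erase hb).symm⟩

theorem Separated.two_mul_card_add_le (hT : T.Nontrivial) (h : Separated 1 T T) :
    2 * #T + #(gapStarts r T) * (r - 1) ≤ K := by
  have hsub : gapStarts r T ⊆ T := filter_subset _ _
  calc 2 * #T + #(gapStarts r T) * (r - 1)
      = ∑ a ∈ T, (2 + if a ∈ gapStarts r T then r - 1 else 0) := by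
        rw [sum_add_distrib, ← sum_filter, filter_mem_eq_inter, inter_eq_right.2 hsub, sum_const,
          sum_const, smul_eq_mul, smul_eq_mul, mul_comm 2]
    _ ≤ K := sum_le_of_forall_le_val_sub hT fun a ha b hb hab ↦ by
        have htwo := h a ha b hb hab
        split_ifs with hgap
        · have := (mem_filter.1 hgap).2 b hb hab.symm
          lia
        · exact htwo

theorem Separated.three_mul_add_le {s : ℕ} (hr : 2 ≤ r) (hs : 2 ≤ s) (hA : s ≤ #A) (hB : s ≤ #B)
    (hAA : Separated 1 A A) (hBB : Separated 1 B B) (hAB : Separated r A B)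
    (hBA : Separated r B A) : 3 * s + 2 * r ≤ K + 4 := by
  have hA₂ : A.Nontrivial := one_lt_card_iff_nontrivial.1 (by lia)
  have hone : Separated 1 (A ∪ B) (A ∪ B) := by
    intro a ha b hb hab
    rcases mem_union.1 ha with ha | ha <;> rcases mem_union.1 hb with hb | hb
    · exact hAA a ha b hb hab
    · exact (Nat.le_of_lt hr).trans_lt (hAB a ha b hb hab)
    · exact (Nat.le_of_lt hr).trans_lt (hBA a ha b hb hab)
    · exact hBB a ha b hb hab
  have hsum := hone.two_mul_card_add_le (r := r) (hA₂.mono subset_union_left)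
  have hinter := card_le_card (inter_subset_gapStarts hAB hBA)
  have htwo := two_le_card_gapStarts hA₂ (card_pos.1 (by lia)) hAB hBA
  have hunion := card_union_add_card_inter A B
  have hinterA := card_le_card (inter_subset_left (s₁ := A) (s₂ := B))
  obtain ⟨r, rfl⟩ := Nat.exists_eq_add_of_le' hr
  obtain ⟨g, hg⟩ := Nat.exists_eq_add_of_le' htwo
  have hmul : (g + 2) * (r + 2 - 1) = g * r + g + 2 * r + 2 := by
    rw [show r + 2 - 1 = r + 1 by lia]
    ring
  rw [hg, hmul] at hsum
  lia

end CyclicGaps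

section Attachments

variable {V : Type*} {G : SimpleGraph V}

/-- The vertex of the nonempty list `C` in position `τ`, positions being read cyclically. -/
def cycleVertex (C : List V) [NeZero C.length] (τ : ZMod C.length) : V :=
  C[τ.val]'(ZMod.val_lt τ)

open Classical in
/-- The positions on the cycle `C` of the neighbours of `x`. -/
noncomputable def attachments (G : SimpleGraph V) (C : List V) [NeZero C.length] (x : V) :
    Finset (ZMod C.length) :=
  {τ | G.Adj x (cycleVertex C τ)}

section

variable {C : List V} [NeZero C.length]

theorem mem_attachments {x : V} {τ : ZMod C.length} :
    τ ∈ attachments G C x ↔ G.Adj x (cycleVertex C τ) := by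
  simp [attachments]

theorem exists_cycleVertex_eq {z : V} (hz : z ∈ C) : ∃ τ, cycleVertex C τ = z := by
  obtain ⟨i, hi, rfl⟩ := List.mem_iff_getElem.1 hz
  exact ⟨(i : ZMod C.length), by simp [cycleVertex, ZMod.val_cast_of_lt hi]⟩

theorem getElem_rotate_val (τ σ : ZMod C.length) :
    (C.rotate τ.val)[σ.val]'(by simpa using ZMod.val_lt σ) = cycleVertex C (τ + σ) := by
  simp [cycleVertex, List.getElem_rotate, ZMod.val_add, add_comm]

theorem rotate_val_eq_cons {τ τ' : ZMod C.length} (hne : τ ≠ τ') :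
    ∃ mid rest, C.rotate τ.val = cycleVertex C τ :: (mid ++ cycleVertex C τ' :: rest) ∧
      mid.length + 1 = (τ' - τ).val := by
  obtain ⟨d, hd⟩ := Nat.exists_eq_succ_of_ne_zero
    (mt (ZMod.val_eq_zero _).1 (sub_ne_zero.2 hne.symm))
  have hlt : d + 1 < (C.rotate τ.val).length := by
    rw [← Nat.succ_eq_add_one, ← hd, List.length_rotate]
    exact ZMod.val_lt _
  have hhead := getElem_rotate_val τ 0
  have hget := getElem_rotate_val τ (τ' - τ)
  simp only [ZMod.val_zero, add_zero, hd, add_sub_cancel] at hhead hget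
  obtain ⟨x, l, hl⟩ := List.exists_cons_of_length_pos (l := C.rotate τ.val) (by lia)
  simp only [hl, List.getElem_cons_zero, Nat.succ_eq_add_one, List.getElem_cons_succ,
    List.length_cons, add_lt_add_iff_right] at hhead hget hlt
  refine ⟨l.take d, l.drop (d + 1), ?_, by simp; lia⟩
  rw [hl, ← hhead, ← hget, ← List.drop_eq_getElem_cons, List.take_append_drop]

theorem le_card_attachments_add_length [G.LocallyFinite] {δ : ℕ} (hδ : ∀ v, δ ≤ G.degree v)
    {R : List V} (hR : R.Nodup) {x : V} (hx : x ∈ R) (hCR : ∀ z, G.Adj x z → z ∈ C ++ R) :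
    δ + 1 ≤ (attachments G C x).card + R.length := by
  classical
  have hsub : G.neighborFinset x ⊆
      (attachments G C x).image (cycleVertex C) ∪ R.toFinset.erase x := by
    intro z hz
    rw [mem_neighborFinset] at hz
    rcases List.mem_append.1 (hCR z hz) with hzC | hzR
    · obtain ⟨τ, rfl⟩ := exists_cycleVertex_eq hzC
      exact Finset.mem_union_left _ (Finset.mem_image_of_mem _ (mem_attachments.2 hz))
    · exact Finset.mem_union_right _ (Finset.mem_erase.2 ⟨hz.ne', List.mem_toFinset.2 hzR⟩)
  have hcard := (Finset.card_le_card hsub).trans (Finset.card_union_le _ _)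
  rw [card_neighborFinset_eq_degree, Finset.card_erase_of_mem (List.mem_toFinset.2 hx),
    List.toFinset_card_of_nodup hR] at hcard
  have himage := Finset.card_image_le (s := attachments G C x) (f := cycleVertex C)
  have := hδ x
  have := List.length_pos_of_mem hx
  lia

end

theorem IsMaxLollipop.not_adj_of_adj {C R rest : List V} {t t' u : V}
    (h : IsMaxLollipop G C (u :: R)) (hcycle : IsCycleList G (t :: t' :: rest))
    (hperm : (t :: t' :: rest).Perm C) (ht : G.Adj u t) : ¬G.Adj u t' := by
  intro ht'
  have hrot : IsCycleList G (t' :: rest ++ [t]) := IsCycleList.append_comm (a := [t]) hcycle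
  have hrotperm : (t' :: rest ++ [t]).Perm C := List.perm_append_comm.trans hperm
  have hR := (List.isChain_append.1 h.isPathList.isChain).2.1
  have hchain : (t' :: rest ++ [t] ++ u :: R).IsChain G.Adj := by
    rw [List.isChain_append, List.getLast?_concat]
    exact ⟨hrot.isChain, hR, by simpa using ht.symm⟩
  have hlen := h.length_le_of_perm (C' := t' :: rest ++ [t] ++ [u]) (R' := R)
    (by simpa using hrotperm.append_right (u :: R)) (by simpa using hchain) (by
      rw [List.getLast?_concat]
      simpa using ht')
  simp [← hperm.length_eq] at hlen

theorem IsMaxLollipop.length_le_of_adj {C R S mid rest : List V} {t t' : V}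
    (h : IsMaxLollipop G C R) (hcycle : IsCycleList G (t :: (mid ++ t' :: rest)))
    (hperm : (t :: (mid ++ t' :: rest)).Perm C) (hS : S.Perm R) (hSchain : S.IsChain G.Adj)
    (hS₀ : S ≠ []) (ht : ∀ x ∈ S.head?, G.Adj t x) (ht' : ∀ x ∈ S.getLast?, G.Adj x t') :
    R.length ≤ mid.length := by
  have hrot : IsCycleList G (t' :: rest ++ t :: mid) :=
    IsCycleList.append_comm (a := t :: mid) (by simpa using hcycle)
  have hback : (t' :: (rest ++ [t])).IsChain G.Adj := hrot.isChain.infix ⟨[], mid, by simp⟩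
  have hmid : (t' :: mid.reverse).IsChain G.Adj := by
    have : (mid ++ [t']).IsChain G.Adj := hcycle.isChain.infix ⟨[t], rest, by simp⟩
    simpa using isChain_adj_reverse.2 this
  rw [List.isChain_cons] at hback
  have hchain : (rest ++ [t] ++ (S ++ t' :: mid.reverse)).IsChain G.Adj := by
    rw [List.isChain_append, List.isChain_append (l₁ := S), List.getLast?_concat,
      List.head?_append_of_ne_nil _ hS₀]
    exact ⟨hback.2, ⟨hSchain, hmid, by simpa using ht'⟩, by simpa using ht⟩
  have hperm' : (rest ++ [t] ++ (S ++ t' :: mid.reverse)).Perm (C ++ R) := by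
    classical
    refine List.Perm.trans ?_ (hperm.append hS)
    rw [List.perm_iff_count]
    intro z
    simp only [List.count_append, List.count_cons, List.count_reverse, List.count_nil]
    lia
  have hlen := h.length_le_of_perm (C' := rest ++ [t] ++ (S ++ [t'])) (R' := mid.reverse)
    (by simpa using hperm') (by simpa using hchain) (by
      rw [← List.append_assoc, List.getLast?_concat, List.append_assoc,
        List.head?_append_of_ne_nil _ (by simp)]
      simpa using hback.1)
  simp only [← hperm.length_eq, ← hS.length_eq, List.length_append, List.length_cons,
    List.length_nil] at hlen ⊢
  lia

theorem IsMaxLollipop.mem_of_adj_getLast {C R : List V} {x z : V}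
    (h : IsMaxLollipop G C (R ++ [x])) (hxz : G.Adj x z) : z ∈ C ++ (R ++ [x]) := by
  have hrev : IsPathList G (x :: (C ++ R).reverse) := by simpa using h.isPathList.reverse
  have hz := hrev.mem_of_adj_head (fun l hl ↦ (h.length_le l hl).trans (by simp; lia)) hxz
  simp only [List.mem_reverse, List.mem_append] at hz ⊢
  tauto

theorem IsMaxLollipop.exists_reverse {C R : List V} {x z : V} (h : IsMaxLollipop G C (R ++ [x]))
    (hz : z ∈ C) (hxz : G.Adj x z) : ∃ C', C'.Perm C ∧ IsMaxLollipop G C' (x :: R.reverse) := by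
  obtain ⟨a, b, rfl⟩ := List.append_of_mem hz
  have hcycle : IsCycleList G (b ++ (a ++ [z])) :=
    IsCycleList.append_comm (by simpa using h.isCycleList)
  have hperm : (b ++ (a ++ [z])).Perm (a ++ z :: b) := by
    simpa using List.perm_append_comm (l₁ := b) (l₂ := a ++ [z])
  have hR := isChain_adj_reverse.2 (List.isChain_append.1 h.isPathList.isChain).2.1
  rw [List.reverse_concat] at hR
  refine ⟨_, hperm, h.of_perm hcycle hperm (by simpa using (R ++ [x]).reverse_perm)
    (List.isChain_append.2 ⟨hcycle.isChain, hR, ?_⟩)⟩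
  rw [← List.append_assoc, List.getLast?_concat]
  simpa using hxz.symm

theorem IsMaxLollipop.separated_one_attachments {C C' R : List V} [NeZero C.length] {x : V}
    (h : IsMaxLollipop G C' (x :: R)) (hC : IsCycleList G C) (hC' : C'.Perm C) :
    Separated 1 (attachments G C x) (attachments G C x) := by
  intro τ hτ τ' hτ' hne
  obtain ⟨mid, rest, hrot, hmid⟩ := rotate_val_eq_cons hne
  rw [mem_attachments] at hτ hτ'
  obtain rfl | hmid₀ := eq_or_ne mid []
  · exact absurd hτ' (h.not_adj_of_adj (hrot ▸ hC.rotate _)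
      (hrot ▸ (C.rotate_perm _).trans hC'.symm) hτ)
  · have := List.length_pos_of_ne_nil hmid₀
    lia

theorem IsMaxLollipop.separated_attachments {C R S : List V} [NeZero C.length] {x y : V}
    (h : IsMaxLollipop G C R) (hS : S.Perm R) (hSchain : S.IsChain G.Adj)
    (hx : S.head? = some x) (hy : S.getLast? = some y) :
    Separated R.length (attachments G C x) (attachments G C y) := by
  intro τ hτ τ' hτ' hne
  obtain ⟨mid, rest, hrot, hmid⟩ := rotate_val_eq_cons hne
  rw [mem_attachments] at hτ hτ'
  have := h.length_le_of_adj (hrot ▸ h.isCycleList.rotate _) (hrot ▸ C.rotate_perm _) hS hSchain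
    (by rintro rfl; simp at hx) (by simpa [hx] using hτ.symm) (by simpa [hy] using hτ')
  lia

theorem IsMaxLollipop.three_mul_le_length [G.LocallyFinite] (hG : G.IsVertexConnected 2) {δ : ℕ}
    (hδ : ∀ v, δ ≤ G.degree v) {C R : List V} (h : IsMaxLollipop G C R) (hR : 2 ≤ R.length) :
    3 * δ ≤ (C ++ R).length + 1 := by
  have hC := h.two_mul_le_length hG hδ (List.ne_nil_of_length_pos (by lia))
  rw [List.length_append]
  by_contra! hlt
  have : NeZero C.length := ⟨by lia⟩
  obtain ⟨u, R₁, hu⟩ := List.exists_cons_of_ne_nil (List.ne_nil_of_length_pos (l := R) (by lia))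
  obtain ⟨R₂, w, hw⟩ := (List.eq_nil_or_concat' R).resolve_left (by rintro rfl; simp at hR)
  obtain ⟨-, hRchain, -⟩ := List.isChain_append.1 h.isPathList.isChain
  obtain ⟨-, hRnodup, -⟩ := List.nodup_append.1 h.isPathList.nodup
  have hwcard : δ + 1 ≤ (attachments G C w).card + R.length :=
    le_card_attachments_add_length hδ hRnodup (by simp [hw])
      fun z hz ↦ hw ▸ (hw ▸ h).mem_of_adj_getLast hz
  obtain ⟨β, hβ⟩ : (attachments G C w).Nonempty := Finset.card_pos.1 (by lia)
  obtain ⟨C', hC', hrev⟩ := (hw ▸ h).exists_reverse (List.getElem_mem (ZMod.val_lt β))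
    (mem_attachments.1 hβ)
  have hRrev : w :: R₂.reverse = R₁.reverse ++ [u] := by
    simpa [hw] using congrArg List.reverse hu
  have hucard : δ + 1 ≤ (attachments G C u).card + R.length :=
    le_card_attachments_add_length hδ hRnodup (by simp [hu]) fun z hz ↦ by
      have := (hRrev ▸ hrev).mem_of_adj_getLast hz
      simpa [hu, hC'.mem_iff, or_comm] using this
  have hhead : R.head? = some u := by simp [hu]
  have hlast : R.getLast? = some w := by simp [hw]
  have := Separated.three_mul_add_le (s := δ + 1 - R.length) hR (by lia) (by lia) (by lia)
    ((hu ▸ h).separated_one_attachments h.isCycleList (.refl C))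
    (hrev.separated_one_attachments h.isCycleList hC')
    (h.separated_attachments (.refl R) hRchain hhead hlast)
    (h.separated_attachments R.reverse_perm (isChain_adj_reverse.2 hRchain) (by simpa) (by simpa))
  lia

end Attachments

section DegreeBounds

variable {V : Type*} {G : SimpleGraph V}

theorem IsCycleList.exists_isPathList_length_eq_add_one (hG : G.IsVertexConnected 2) {C : List V}
    (hC : IsCycleList G C) {z : V} (hz : z ∉ C) :
    ∃ l, IsPathList G l ∧ l.length = C.length + 1 := by
  obtain ⟨a, b, C, rfl⟩ : ∃ a b C', C = a :: b :: C' := by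
    match C, hC.three_le_length with
    | a :: b :: C', _ => exact ⟨a, b, C', rfl⟩
  have hba : b ≠ a := fun h ↦ List.not_nodup_cons_of_mem (by simp [h]) hC.nodup
  obtain ⟨u, hu, w, hw, -, -, huw⟩ := exists_adj_of_isVertexConnected hG a {x | x ∈ a :: b :: C}
    (x := b) (by simp) hba hz (by rintro rfl; exact hz List.mem_cons_self)
  obtain ⟨l₁, l₂, hl⟩ := List.append_of_mem hu
  have hperm : (u :: l₂ ++ l₁).Perm (a :: b :: C) := hl ▸ List.perm_append_comm
  have hcycle : IsCycleList G (u :: l₂ ++ l₁) := IsCycleList.append_comm (hl ▸ hC)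
  exact ⟨w :: (u :: l₂ ++ l₁), ⟨List.isChain_cons_cons.2 ⟨huw.symm, hcycle.isChain⟩,
    List.nodup_cons.2 ⟨fun h ↦ hw (hperm.mem_iff.1 h), hcycle.nodup⟩⟩,
    congrArg (· + 1) hperm.length_eq⟩

theorem IsCycleList.natCard_le_length (hG : G.IsVertexConnected 2) {C : List V}
    (hC : IsCycleList G C) (hmax : ∀ l, IsPathList G l → l.length ≤ C.length) :
    Nat.card V ≤ C.length := by
  obtain ⟨_, _⟩ := Nat.card_pos_iff.1 (Nat.zero_lt_of_lt hG.1)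
  have hspan z : z ∈ C := by
    by_contra hz
    obtain ⟨l, hl, hlen⟩ := hC.exists_isPathList_length_eq_add_one hG hz
    have := hmax l hl
    lia
  classical
  have := Fintype.ofFinite V
  rw [Nat.card_eq_fintype_card, ← List.toFinset_card_of_nodup hC.nodup, ← Finset.card_univ]
  exact Finset.card_le_card fun z _ ↦ List.mem_toFinset.2 (hspan z)

theorem natCard_le_circumference_or_two_mul_le [G.LocallyFinite] (hG : G.IsVertexConnected 2)
    {δ : ℕ} (hδ : ∀ v, δ ≤ G.degree v) :
    Nat.card V ≤ G.circumference ∨ 2 * δ ≤ G.circumference := by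
  obtain ⟨_, _⟩ := Nat.card_pos_iff.1 (Nat.zero_lt_of_lt hG.1)
  obtain ⟨C, R, h, -⟩ := exists_isMaxLollipop fun v ↦ two_le_degree_of_isVertexConnected hG v
  have hC := h.isCycleList.length_le_circumference
  rcases eq_or_ne R [] with rfl | hR
  · exact .inl ((h.isCycleList.natCard_le_length hG (by simpa using h.length_le)).trans hC)
  · exact .inr ((h.two_mul_le_length hG hδ hR).trans hC)

theorem longestPathOrder_le_circumference_add_one_or_three_mul_le [G.LocallyFinite]
    (hG : G.IsVertexConnected 2) {δ : ℕ} (hδ : ∀ v, δ ≤ G.degree v) :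
    G.longestPathOrder ≤ G.circumference + 1 ∨ 3 * δ ≤ G.longestPathOrder + 1 := by
  obtain ⟨_, _⟩ := Nat.card_pos_iff.1 (Nat.zero_lt_of_lt hG.1)
  obtain ⟨C, R, h, hlen⟩ := exists_isMaxLollipop fun v ↦ two_le_degree_of_isVertexConnected hG v
  have hC := h.isCycleList.length_le_circumference
  rw [← hlen]
  rcases lt_or_ge R.length 2 with hR | hR
  · rw [List.length_append]
    lia
  · exact .inr (h.three_mul_le_length hG hδ hR)

theorem longestPathOrder_le_natCard [Finite V] : G.longestPathOrder ≤ Nat.card V := by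
  cases isEmpty_or_nonempty V
  · simp [longestPathOrder]
  have := Fintype.ofFinite V
  obtain ⟨l, hl, hlen⟩ := exists_isPathList_length_eq (G := G)
  rw [← hlen, Nat.card_eq_fintype_card]
  exact hl.nodup.length_le_card

theorem three_le_longestPathOrder (hG : G.IsVertexConnected 2) : 3 ≤ G.longestPathOrder := by
  classical
  obtain ⟨_, _⟩ := Nat.card_pos_iff.1 (Nat.zero_lt_of_lt hG.1)
  have := Fintype.ofFinite V
  obtain ⟨C, R, h, hlen⟩ := exists_isMaxLollipop fun v ↦ two_le_degree_of_isVertexConnected hG v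
  have h3 := h.isCycleList.three_le_length
  rw [List.length_append] at hlen
  lia

end DegreeBounds

section Vines

variable {V : Type*} {G : SimpleGraph V} {v : ℕ → V} {n : ℕ}

/-- `v 0, …, v n` are the consecutive vertices of a path; the values of `v` beyond `n` are
irrelevant. -/
structure IsPathSeq (G : SimpleGraph V) (v : ℕ → V) (n : ℕ) : Prop where
  injOn : Set.InjOn v (Set.Iic n)
  adj : ∀ i < n, G.Adj (v i) (v (i + 1))

theorem IsPathSeq.eq (hv : IsPathSeq G v n) {i j : ℕ} (hi : i ≤ n) (hj : j ≤ n)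
    (h : v i = v j) : i = j :=
  hv.injOn hi hj h

/-- The part of the path `v 0, v 1, …` after index `a` and up to index `b`. -/
def pathSegment (v : ℕ → V) (a b : ℕ) : List V :=
  (List.range' (a + 1) (b - a)).map v

theorem mem_pathSegment {a b : ℕ} {z : V} :
    z ∈ pathSegment v a b ↔ ∃ k, a < k ∧ k ≤ b ∧ v k = z := by
  simp only [pathSegment, List.mem_map, List.mem_range'_1]
  exact exists_congr fun k ↦ by lia

theorem length_pathSegment (v : ℕ → V) (a b : ℕ) : (pathSegment v a b).length = b - a := by
  simp [pathSegment]

theorem pathSegment_succ {a b : ℕ} (hab : a ≤ b) :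
    pathSegment v a (b + 1) = pathSegment v a b ++ [v (b + 1)] := by
  rw [pathSegment, Nat.sub_add_comm hab, List.range'_1_concat, List.map_append]
  simp only [pathSegment, List.map_cons, List.map_nil]
  congr 3
  lia

theorem getLast?_cons_pathSegment {a b : ℕ} (hab : a ≤ b) :
    (v a :: pathSegment v a b).getLast? = some (v b) := by
  induction b, hab using Nat.le_induction with
  | base => simp [pathSegment]
  | succ b hab _ => rw [pathSegment_succ hab, ← List.cons_append, List.getLast?_concat]

theorem IsPathSeq.isPathList_cons_pathSegment (hv : IsPathSeq G v n) {a b : ℕ} (hab : a ≤ b)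
    (hb : b ≤ n) : IsPathList G (v a :: pathSegment v a b) := by
  induction b, hab using Nat.le_induction with
  | base => exact ⟨by simp [pathSegment], by simp [pathSegment]⟩
  | succ b hab ih =>
    have ih := ih (by lia)
    rw [pathSegment_succ hab, ← List.cons_append]
    refine ⟨List.isChain_append.2 ⟨ih.isChain, .singleton _, ?_⟩, ?_⟩
    · rw [getLast?_cons_pathSegment hab]
      simpa using hv.adj b hb
    · refine List.nodup_append.2 ⟨ih.nodup, List.nodup_singleton _, ?_⟩
      rintro _ hz _ hw rfl
      rw [List.mem_singleton] at hw
      rw [List.mem_cons, mem_pathSegment] at hz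
      rcases hz with hz | ⟨k, -, hkb, hk⟩
      · have := hv.eq (by lia) hb (hz.symm.trans hw)
        lia
      · have := hv.eq (by lia) hb (hk.trans hw)
        lia

theorem isChain_append_of_getLast? {A B : List V} {a : V} (hA : A.IsChain G.Adj)
    (ha : A.getLast? = some a) (hB : (a :: B).IsChain G.Adj) : (A ++ B).IsChain G.Adj := by
  refine List.isChain_append.2 ⟨hA, hB.tail, ?_⟩
  simp only [ha, Option.mem_some_iff, forall_eq']
  exact (List.isChain_cons.1 hB).1

theorem getLast?_append_of_getLast? {A B : List V} {a b : V} (ha : A.getLast? = some a)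
    (hb : (a :: B).getLast? = some b) : (A ++ B).getLast? = some b := by
  rcases eq_or_ne B [] with rfl | hB
  · simp_all
  · rw [List.getLast?_append_of_ne_nil _ hB, ← hb, List.getLast?_cons_of_ne_nil hB]

/-- `q` lists the inner vertices of a walk from `v a` to `z`, none of them on the path
`v 0, …, v n`; the inner vertices may repeat. -/
structure IsBridge (G : SimpleGraph V) (v : ℕ → V) (n a : ℕ) (q : List V) (z : V) : Prop where
  isChain : (v a :: (q ++ [z])).IsChain G.Adj
  notMem : ∀ i ≤ n, v i ∉ q

/-- A vine on the path `v 0, …, v n`, as used by Dirac: paths `v (x k), Q k, v (y (k + 1))` for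
`k < m`, disjoint from each other and meeting the path in their ends only, such that consecutive
ones interlace. The conventions `y 0 = 1` and `x m = n` make the conditions uniform in `k`. -/
structure IsVine (G : SimpleGraph V) (v : ℕ → V) (n m : ℕ) (x y : ℕ → ℕ) (Q : ℕ → List V) :
    Prop extends IsPathSeq G v n where
  x_zero : x 0 = 0
  y_zero : y 0 = 1
  x_last : x m = n
  y_last : y m = n
  x_lt_y : ∀ k < m, x k < y k
  y_le_x_succ : ∀ k < m, y k ≤ x (k + 1)
  y_lt_y_succ : ∀ k < m, y k < y (k + 1)
  isBridge : ∀ k < m, IsBridge G v n (x k) (Q k) (v (y (k + 1)))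
  nodup : ∀ k < m, (Q k).Nodup
  disjoint : ∀ j k, j < k → k < m → (Q j).Disjoint (Q k)

/-- `W` is a path from `v a` to `v b` all of whose vertices are either among `v 0, …, v b` or inner
vertices of the first `j` members `Q 0, …, Q (j - 1)` of a vine. -/
structure IsVineArc (G : SimpleGraph V) (v : ℕ → V) (Q : ℕ → List V) (j a b : ℕ) (W : List V) :
    Prop extends IsPathList G W where
  head : W.head? = some (v a)
  getLast : W.getLast? = some (v b)
  mem : ∀ z ∈ W, (∃ k ≤ b, v k = z) ∨ ∃ k < j, z ∈ Q k

namespace IsVine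

variable {m : ℕ} {x y : ℕ → ℕ} {Q : ℕ → List V}

theorem y_le_y (h : IsVine G v n m x y Q) {i j : ℕ} (hij : i ≤ j) (hj : j ≤ m) : y i ≤ y j := by
  induction j, hij using Nat.le_induction with
  | base => rfl
  | succ j _ ih => exact (ih (by lia)).trans (h.y_lt_y_succ j hj).le

theorem y_le (h : IsVine G v n m x y Q) {i : ℕ} (hi : i ≤ m) : y i ≤ n :=
  h.y_last ▸ h.y_le_y hi le_rfl

theorem x_le_y (h : IsVine G v n m x y Q) {i : ℕ} (hi : i ≤ m) : x i ≤ y i := by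
  rcases hi.lt_or_eq with hlt | rfl
  · exact (h.x_lt_y i hlt).le
  · rw [h.x_last, h.y_last]

theorem isPathList_member (h : IsVine G v n m x y Q) {j : ℕ} (hj : j < m) :
    IsPathList G (Q j ++ [v (y (j + 1))]) := by
  refine ⟨(h.isBridge j hj).isChain.tail,
    List.nodup_append.2 ⟨h.nodup j hj, List.nodup_singleton _, ?_⟩⟩
  rintro z hz _ hw rfl
  exact (h.isBridge j hj).notMem _ (h.y_le hj) (List.mem_singleton.1 hw ▸ hz)

theorem isPathList_append_pathSegment (h : IsVine G v n m x y Q) {j b : ℕ} (hj : j ≤ m)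
    (hyb : y j ≤ b) (hb : b ≤ n) {W : List V} (hW : IsVineArc G v Q j (x j) (y j) W) :
    IsPathList G (W ++ pathSegment v (y j) b) := by
  have hseg := h.isPathList_cons_pathSegment hyb hb
  refine ⟨isChain_append_of_getLast? hW.isChain hW.getLast hseg.isChain,
    List.nodup_append.2 ⟨hW.nodup, hseg.nodup.tail, ?_⟩⟩
  rintro z hz _ hw rfl
  obtain ⟨l, hl, hlb, rfl⟩ := mem_pathSegment.1 hw
  rcases hW.mem _ hz with ⟨k, hk, hkl⟩ | ⟨k, hk, hQ⟩
  · have := h.eq (by lia) (by lia) hkl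
    lia
  · exact (h.isBridge k (by lia)).notMem l (by lia) hQ

theorem isVineArc_succ (h : IsVine G v n m x y Q) {j b : ℕ} (hj : j < m) (hyb : y j ≤ b)
    (hb : b < y (j + 1)) {W : List V} (hW : IsVineArc G v Q j (x j) (y j) W) :
    IsVineArc G v Q (j + 1) b (y (j + 1))
      ((W ++ pathSegment v (y j) b).reverse ++ (Q j ++ [v (y (j + 1))])) := by
  have hyn := h.y_le (i := j + 1) hj
  have hseg := h.isPathList_append_pathSegment hj.le hyb (by lia) hW
  have hmem z (hz : z ∈ W ++ pathSegment v (y j) b) :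
      (∃ k ≤ b, v k = z) ∨ ∃ k < j, z ∈ Q k := by
    rcases List.mem_append.1 hz with hz | hz
    · exact (hW.mem z hz).imp_left fun ⟨k, hk, hkz⟩ ↦ ⟨k, hk.trans hyb, hkz⟩
    · obtain ⟨k, -, hk, rfl⟩ := mem_pathSegment.1 hz
      exact .inl ⟨k, hk, rfl⟩
  have hlast : (W ++ pathSegment v (y j) b).reverse.getLast? = some (v (x j)) := by
    rw [List.getLast?_reverse, List.head?_append, hW.head, Option.some_or]
  refine ⟨⟨isChain_append_of_getLast? hseg.reverse.isChain hlast (h.isBridge j hj).isChain,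
    List.nodup_append.2 ⟨hseg.reverse.nodup, (h.isPathList_member hj).nodup, ?_⟩⟩, ?_, ?_, ?_⟩
  · rintro z hz _ hw rfl
    rw [List.mem_append, List.mem_singleton] at hw
    rcases hmem z (List.mem_reverse.1 hz), hw with ⟨⟨k, hk, rfl⟩ | ⟨k, hk, hQ⟩, hw | hw⟩
    · exact (h.isBridge j hj).notMem k (by lia) hw
    · have := h.eq (by lia) hyn hw
      lia
    · exact h.disjoint k j hk hj hQ hw
    · exact (h.isBridge k (by lia)).notMem _ hyn (hw ▸ hQ)
  · rw [List.head?_append, List.head?_reverse, getLast?_append_of_getLast? hW.getLast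
      (getLast?_cons_pathSegment hyb), Option.some_or]
  · rw [← List.append_assoc, List.getLast?_concat]
  · intro z hz
    rw [List.mem_append, List.mem_append, List.mem_reverse, List.mem_singleton] at hz
    rcases hz with hz | hz | rfl
    · exact (hmem z hz).imp (fun ⟨k, hk, hkz⟩ ↦ ⟨k, by lia, hkz⟩) fun ⟨k, hk, hz⟩ ↦ ⟨k, by lia, hz⟩
    · exact .inr ⟨j, j.lt_succ_self, hz⟩
    · exact .inl ⟨_, le_rfl, rfl⟩

theorem exists_isVineArc (h : IsVine G v n m x y Q) {i j : ℕ} (hij : i ≤ j) (hj : j < m) :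
    ∃ W, IsVineArc G v Q j (x j) (y j) W ∧
      (y i - x i) + 1 + (j - i) + ∑ l ∈ Finset.Ico i j, (x (l + 1) - y l) ≤ W.length := by
  induction j, hij using Nat.le_induction with
  | base =>
    have hxy := (h.x_lt_y i hj).le
    refine ⟨v (x i) :: pathSegment v (x i) (y i), ⟨h.isPathList_cons_pathSegment hxy
      (h.y_le hj.le), rfl, getLast?_cons_pathSegment hxy, fun z hz ↦ .inl ?_⟩, ?_⟩
    · rw [List.mem_cons, mem_pathSegment] at hz
      rcases hz with rfl | ⟨k, -, hk, rfl⟩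
      · exact ⟨_, hxy, rfl⟩
      · exact ⟨k, hk, rfl⟩
    · simp [length_pathSegment]
  | succ j hij ih =>
    obtain ⟨W, hW, hlen⟩ := ih (by lia)
    refine ⟨_, h.isVineArc_succ (by lia) (h.y_le_x_succ j (by lia)) (h.x_lt_y (j + 1) hj) hW, ?_⟩
    rw [Finset.sum_Ico_succ_top hij]
    simp only [List.length_append, List.length_reverse, length_pathSegment, List.length_singleton]
    lia

theorem add_le_circumference [Finite V] (h : IsVine G v n m x y Q) {i j : ℕ} (hij : i < j)
    (hj : j ≤ m) : (y i - x i) + (y j - x j) + (j - i) +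
      ∑ l ∈ Finset.Ico i j, (x (l + 1) - y l) ≤ G.circumference := by
  obtain _ | j := j
  · lia
  obtain ⟨W, hW, hlen⟩ := h.exists_isVineArc (Nat.lt_succ_iff.1 hij) hj
  have hx := h.x_lt_y i (by lia)
  have hy := h.y_lt_y_succ j hj
  have hxy := h.x_le_y hj
  have hyx := h.y_le_x_succ j hj
  have harc := h.isVineArc_succ hj (b := y (j + 1) - 1) (by lia) (by lia) hW
  have hadj : G.Adj (v (y (j + 1))) (v (y (j + 1) - 1)) := by
    have := h.adj (y (j + 1) - 1) (by have := h.y_le hj; lia)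
    rw [Nat.sub_add_cancel (by lia)] at this
    exact this.symm
  have hcycle := IsCycleList.length_le_circumference ⟨harc.toIsPathList, by
      simp only [List.length_append, List.length_reverse, length_pathSegment,
        List.length_singleton]
      lia, by
      simpa only [harc.head, harc.getLast, Option.mem_some_iff, forall_eq'] using hadj⟩
  simp only [List.length_append, List.length_reverse, length_pathSegment, List.length_singleton]
    at hcycle
  rw [Finset.sum_Ico_succ_top (by lia)]
  lia

end IsVine

end Vines

section VineCycles

open Finset

theorem sum_Ico_add_le_of_forall_add_le {f : ℕ → ℕ} {c d e a : ℕ}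
    (h : ∀ i j, a ≤ i → i < j → j < a + 2 * e + d → f i + f j + j ≤ c + i) :
    ∑ k ∈ Ico a (a + 2 * e + d), f k + e * (d + e) ≤
      ∑ k ∈ Ico (a + e) (a + e + d), f k + e * c := by
  induction e generalizing a with
  | zero => simp
  | succ e ih =>
    have hinner := ih (a := a + 1) fun i j hi hij hj ↦ h i j (by lia) hij (by lia)
    have houter := h a (a + 2 * e + d + 1) le_rfl (by lia) (by lia)
    have hsum : ∑ k ∈ Ico a (a + 2 * (e + 1) + d), f k =
        f a + ∑ k ∈ Ico (a + 1) (a + 1 + 2 * e + d), f k + f (a + 2 * e + d + 1) := by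
      rw [show a + 2 * (e + 1) + d = a + 1 + 2 * e + d + 1 by lia,
        sum_eq_sum_Ico_succ_bot (by lia), sum_Ico_succ_top (by lia),
        show a + 2 * e + d + 1 = a + 1 + 2 * e + d by lia, ← add_assoc (f a)]
    rw [hsum, show a + (e + 1) = a + 1 + e by lia]
    nlinarith

variable {V : Type*} {G : SimpleGraph V} {v : ℕ → V} {n : ℕ} {x y : ℕ → ℕ} {Q : ℕ → List V}

namespace IsVine

theorem y_eq {m : ℕ} (h : IsVine G v n m x y Q) {k : ℕ} (hk : k ≤ m) :
    y k = 1 + ∑ l ∈ Ico 0 k, (x (l + 1) - y l) + ∑ l ∈ Ico 1 (k + 1), (y l - x l) := by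
  induction k with
  | zero => simp [h.y_zero]
  | succ k ih =>
    have hy := ih (by lia)
    have hyx := h.y_le_x_succ k hk
    have hxy := h.x_le_y hk
    rw [sum_Ico_succ_top (by lia), sum_Ico_succ_top (by lia)]
    lia

theorem eq_one_add_sum_add_sum {m : ℕ} (h : IsVine G v n m x y Q) (hm : 1 ≤ m) :
    n = 1 + ∑ l ∈ Ico 0 m, (x (l + 1) - y l) + ∑ l ∈ Ico 1 m, (y l - x l) := by
  have hy := h.y_eq le_rfl
  rwa [sum_Ico_succ_top hm, h.x_last, h.y_last, Nat.sub_self, add_zero] at hy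

theorem sum_y_sub_x_add_le [Finite V] {m : ℕ} (h : IsVine G v n m x y Q) {d e : ℕ}
    (hm : m = 1 + 2 * e + d) : ∑ k ∈ Ico 1 m, (y k - x k) + e * (d + e) ≤
      ∑ k ∈ Ico (1 + e) (1 + e + d), (y k - x k) + e * G.circumference := by
  rw [hm]
  refine sum_Ico_add_le_of_forall_add_le fun i j _ hij hj ↦ ?_
  have := h.add_le_circumference hij (by lia)
  lia

theorem length_le_of_odd [Finite V] {r : ℕ} (h : IsVine G v n (2 * r + 1) x y Q) :
    n + 1 + 2 * r + r * r ≤ (r + 1) * G.circumference := by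
  have hn := h.eq_one_add_sum_add_sum (by lia)
  have hall := h.add_le_circumference (i := 0) (by lia) le_rfl
  have hpairs := h.sum_y_sub_x_add_le (d := 0) (e := r) (by lia)
  rw [h.x_zero, h.y_zero] at hall
  rw [add_zero, zero_add, Ico_self, sum_empty] at hpairs
  rw [add_one_mul]
  lia

theorem two_mul_length_le_of_even [Finite V] {r : ℕ}
    (h : IsVine G v n (2 * (r + 1)) x y Q) :
    2 * (n + 1) + 2 * (r + 1) + 2 * ((r + 1) * (r + 1)) ≤
      (2 * (r + 1) + 1) * G.circumference + 2 := by
  have hn := h.eq_one_add_sum_add_sum (by lia)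
  have hall := h.add_le_circumference (i := 0) (by lia) le_rfl
  have hleft := h.add_le_circumference (i := 0) (j := r + 1) (by lia) (by lia)
  have hright := h.add_le_circumference (i := r + 1) (by lia) le_rfl
  have hpairs := h.sum_y_sub_x_add_le (d := 1) (e := r) (by lia)
  have hsum := sum_Ico_consecutive (fun l ↦ x (l + 1) - y l) (Nat.zero_le (r + 1))
    (show r + 1 ≤ 2 * (r + 1) by lia)
  rw [h.x_zero, h.y_zero] at hall hleft
  rw [Nat.Ico_succ_singleton, sum_singleton, add_comm 1 r] at hpairs
  have hlinear : 2 * (n + 1) + 4 * (r + 1) + 2 * (r * (r + 1)) ≤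
      3 * G.circumference + 2 * (r * G.circumference) + 2 := by lia
  linarith

theorem four_mul_length_add_sq_le [Finite V] {m : ℕ} (h : IsVine G v n m x y Q) (hm : 1 ≤ m) :
    4 * (n + 1) + (m + 1) ^ 2 ≤ 2 * (m + 1) * G.circumference + 5 := by
  rcases Nat.even_or_odd' m with ⟨r, rfl | rfl⟩
  · obtain ⟨r, rfl⟩ := Nat.exists_eq_add_of_le' (show 1 ≤ r by lia)
    linarith [h.two_mul_length_le_of_even]
  · linarith [h.length_le_of_odd]

end IsVine

end VineCycles

section GreedyVine

variable {V : Type*} {G : SimpleGraph V} {v : ℕ → V} {n : ℕ}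

theorem exists_nodup_isChain (b : V) : ∀ (q : List V) (a : V), (a :: (q ++ [b])).IsChain G.Adj →
    ∃ q' ⊆ q, q'.Nodup ∧ (a :: (q' ++ [b])).IsChain G.Adj
  | [], a, h => ⟨[], List.Subset.refl _, List.nodup_nil, h⟩
  | x :: q, a, h => by
    rw [List.cons_append, List.isChain_cons_cons] at h
    obtain ⟨q', hsub, hnodup, hchain⟩ := exists_nodup_isChain b q x h.2
    by_cases hx : x ∈ q'
    · obtain ⟨l₁, l₂, rfl⟩ := List.append_of_mem hx
      refine ⟨x :: l₂, ?_, hnodup.sublist (List.sublist_append_right _ _), ?_⟩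
      · exact List.cons_subset_cons _ fun z hz ↦ hsub (by simp [hz])
      · exact List.isChain_cons_cons.2 ⟨h.1, hchain.infix ⟨x :: l₁, [], by simp⟩⟩
    · exact ⟨x :: q', List.cons_subset_cons _ hsub, List.nodup_cons.2 ⟨hx, hnodup⟩,
        List.isChain_cons_cons.2 ⟨h.1, hchain⟩⟩

namespace IsBridge

theorem of_adj {a : ℕ} {z : V} (h : G.Adj (v a) z) : IsBridge G v n a [] z :=
  ⟨by simpa using h, by simp⟩

theorem snoc {a : ℕ} {q : List V} {w z : V} (h : IsBridge G v n a q w) (hw : ∀ i ≤ n, v i ≠ w)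
    (hwz : G.Adj w z) : IsBridge G v n a (q ++ [w]) z := by
  refine ⟨?_, fun i hi ↦ ?_⟩
  · rw [← List.cons_append]
    exact isChain_append_of_getLast? h.isChain (a := w)
      (by rw [← List.cons_append, List.getLast?_concat]) (by simpa using hwz)
  · rw [List.mem_append, List.mem_singleton, not_or]
    exact ⟨h.notMem i hi, hw i hi⟩

theorem exists_nodup {a : ℕ} {q : List V} {z : V} (h : IsBridge G v n a q z) :
    ∃ q', q'.Nodup ∧ IsBridge G v n a q' z := by
  obtain ⟨q', hsub, hnodup, hchain⟩ := exists_nodup_isChain z q (v a) h.isChain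
  exact ⟨q', hnodup, hchain, fun i hi hmem ↦ h.notMem i hi (hsub hmem)⟩

theorem exists_of_mem {a a' : ℕ} {q q' : List V} {z z' w : V} (h : IsBridge G v n a q z)
    (h' : IsBridge G v n a' q' z') (hw : w ∈ q) (hw' : w ∈ q') :
    ∃ q'', IsBridge G v n a q'' z' := by
  obtain ⟨l₁, l₂, rfl⟩ := List.append_of_mem hw
  obtain ⟨l₃, l₄, rfl⟩ := List.append_of_mem hw'
  refine ⟨l₁ ++ w :: l₄, ?_, fun i hi hmem ↦ ?_⟩
  · rw [List.append_assoc, List.cons_append, ← List.cons_append, List.isChain_split]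
    exact ⟨h.isChain.infix ⟨[], l₂ ++ [z], by simp⟩, h'.isChain.infix ⟨v a' :: l₃, [], by simp⟩⟩
  · rcases List.mem_append.1 hmem with hmem | hmem
    · exact h.notMem i hi (List.mem_append_left _ hmem)
    · exact h'.notMem i hi (List.mem_append_right _ hmem)

end IsBridge

theorem IsPathSeq.exists_isBridge (hG : G.IsVertexConnected 2) (hv : IsPathSeq G v n) {i : ℕ}
    (hi : 0 < i) (hin : i < n) : ∃ a < i, ∃ b, i < b ∧ b ≤ n ∧ ∃ q, IsBridge G v n a q (v b) := by
  by_contra! hcon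
  let S : Set V := {z | (∃ a < i, v a = z) ∨
    ((∀ k ≤ n, v k ≠ z) ∧ ∃ a < i, ∃ q, IsBridge G v n a q z)}
  have hn : v n ∉ S := by
    rintro (⟨a, ha, he⟩ | ⟨h, -⟩)
    · have := hv.eq (by lia) le_rfl he
      lia
    · exact h n le_rfl rfl
  have hne {k : ℕ} (hk : k ≤ n) (hki : k ≠ i) : v k ≠ v i := fun h ↦ hki (hv.eq hk hin.le h)
  obtain ⟨w, hw, z, hz, -, hzi, hwz⟩ := exists_adj_of_isVertexConnected hG (v i) S (x := v 0)
    (.inl ⟨0, hi, rfl⟩) (hne (by lia) (by lia)) hn (hne le_rfl (by lia))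
  obtain ⟨a, ha, q, hq⟩ : ∃ a < i, ∃ q, IsBridge G v n a q z := by
    rcases hw with ⟨a, ha, rfl⟩ | ⟨hoff, a, ha, q, hq⟩
    · exact ⟨a, ha, [], .of_adj hwz⟩
    · exact ⟨a, ha, q ++ [w], hq.snoc hoff hwz⟩
  by_cases hzv : ∃ k ≤ n, v k = z
  · obtain ⟨k, hk, rfl⟩ := hzv
    rcases lt_trichotomy k i with hlt | rfl | hlt
    · exact hz (.inl ⟨k, hlt, rfl⟩)
    · exact hzi rfl
    · exact hcon a ha k hlt hk q hq
  · push Not at hzv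
    exact hz (.inr ⟨hzv, a, ha, q, hq⟩)

open Classical in
/-- The largest index of a vertex of the path `v 0, …, v n` joined by a bridge to one of
`v 0, …, v (i - 1)`; it is `0` if there is no such vertex. -/
noncomputable def bridgeReach (G : SimpleGraph V) (v : ℕ → V) (n i : ℕ) : ℕ :=
  Nat.findGreatest (fun b ↦ ∃ a < i, ∃ q, IsBridge G v n a q (v b)) n

theorem bridgeReach_le (i : ℕ) : bridgeReach G v n i ≤ n :=
  open Classical in Nat.findGreatest_le n

theorem IsBridge.le_bridgeReach {i a b : ℕ} {q : List V} (h : IsBridge G v n a q (v b))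
    (ha : a < i) (hb : b ≤ n) : b ≤ bridgeReach G v n i :=
  open Classical in Nat.le_findGreatest hb ⟨a, ha, q, h⟩

theorem IsPathSeq.lt_bridgeReach (hG : G.IsVertexConnected 2) (hv : IsPathSeq G v n) {i : ℕ}
    (hi : 0 < i) (hin : i < n) : i < bridgeReach G v n i := by
  obtain ⟨a, ha, b, hib, hbn, q, hq⟩ := hv.exists_isBridge hG hi hin
  exact hib.trans_le (hq.le_bridgeReach ha hbn)

theorem IsPathSeq.exists_isBridge_bridgeReach (hG : G.IsVertexConnected 2) (hv : IsPathSeq G v n)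
    {i : ℕ} (hi : 0 < i) (hin : i < n) :
    ∃ a q, a < i ∧ q.Nodup ∧ IsBridge G v n a q (v (bridgeReach G v n i)) := by
  obtain ⟨a, ha, b, -, hbn, q, hq⟩ := hv.exists_isBridge hG hi hin
  obtain ⟨a', ha', q', hq'⟩ : ∃ a < i, ∃ q, IsBridge G v n a q (v (bridgeReach G v n i)) := by
    classical
    exact Nat.findGreatest_spec (P := fun b ↦ ∃ a < i, ∃ q, IsBridge G v n a q (v b)) hbn
      ⟨a, ha, q, hq⟩
  obtain ⟨q'', hnodup, hq''⟩ := hq'.exists_nodup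
  exact ⟨a', q'', ha', hnodup, hq''⟩

theorem exists_iterate_eq_of_lt {f : ℕ → ℕ} {n : ℕ} (hle : ∀ i, f i ≤ n)
    (hlt : ∀ i, 0 < i → i < n → i < f i) (i : ℕ) (hi : 0 < i) (hin : i ≤ n) :
    ∃ m, f^[m] i = n ∧ ∀ k < m, 0 < f^[k] i ∧ f^[k] i < n := by
  rcases hin.lt_or_eq with hin | rfl
  · have hfi := hlt i hi hin
    obtain ⟨m, hm, hk⟩ := exists_iterate_eq_of_lt hle hlt (f i) (by lia) (hle i)
    refine ⟨m + 1, hm, fun k hkm ↦ ?_⟩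
    cases k with
    | zero => exact ⟨hi, hin⟩
    | succ k => exact hk k (by lia)
  · exact ⟨0, rfl, by simp⟩
termination_by n - i

/-- The end indices of the members of the greedy vine, each member reaching as far along the path
as possible. -/
noncomputable def greedyEnd (G : SimpleGraph V) (v : ℕ → V) (n k : ℕ) : ℕ :=
  (bridgeReach G v n)^[k] 1

theorem greedyEnd_succ (k : ℕ) :
    greedyEnd G v n (k + 1) = bridgeReach G v n (greedyEnd G v n k) :=
  Function.iterate_succ_apply' ..

theorem IsBridge.le_greedyEnd_succ {a b k : ℕ} {q : List V} (h : IsBridge G v n a q (v b))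
    (ha : a < greedyEnd G v n k) (hb : b ≤ n) : b ≤ greedyEnd G v n (k + 1) :=
  greedyEnd_succ (G := G) k ▸ h.le_bridgeReach ha hb

theorem le_greedyEnd_one {b : ℕ} (hb : b ≤ n) (h : G.Adj (v 0) (v b)) : b ≤ greedyEnd G v n 1 :=
  (IsBridge.of_adj h).le_greedyEnd_succ (k := 0) Nat.one_pos hb

theorem IsVine.greedyEnd_le_of_adj {m : ℕ} {x : ℕ → ℕ} {Q : ℕ → List V}
    (h : IsVine G v n (m + 2) x (greedyEnd G v n) Q) {a : ℕ} (ha : G.Adj (v n) (v a)) :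
    greedyEnd G v n m ≤ a := by
  by_contra! hlt
  have hn := (IsBridge.of_adj ha.symm).le_greedyEnd_succ hlt le_rfl
  have hy := h.y_lt_y_succ (m + 1) (by lia)
  rw [h.y_last] at hy
  lia

theorem IsPathSeq.exists_isVine_greedyEnd (hG : G.IsVertexConnected 2) (hv : IsPathSeq G v n)
    (hn : 2 ≤ n) : ∃ m x Q, IsVine G v n m x (greedyEnd G v n) Q ∧ 1 ≤ m := by
  obtain ⟨m, hm, hlt⟩ := exists_iterate_eq_of_lt (bridgeReach_le (G := G) (v := v))
    (fun i ↦ hv.lt_bridgeReach hG) 1 Nat.one_pos (by lia)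
  have hm1 : 1 ≤ m := Nat.one_le_iff_ne_zero.2 <| by
    rintro rfl
    exact absurd hm (by simp; lia)
  change ∀ k < m, 0 < greedyEnd G v n k ∧ greedyEnd G v n k < n at hlt
  have hmember k (hk : k < m) := hv.exists_isBridge_bridgeReach hG (hlt k hk).1 (hlt k hk).2
  simp only [← greedyEnd_succ] at hmember
  choose! x Q hx hnodup hbridge using hmember
  have hy k (hk : k < m) : greedyEnd G v n k < greedyEnd G v n (k + 1) :=
    greedyEnd_succ (G := G) k ▸ hv.lt_bridgeReach hG (hlt k hk).1 (hlt k hk).2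
  have hyn k : greedyEnd G v n (k + 1) ≤ n :=
    greedyEnd_succ (G := G) k ▸ bridgeReach_le _
  refine ⟨m, fun k ↦ if k < m then x k else n, Q, ⟨hv, ?_, rfl, by simp, hm, ?_, ?_, hy, ?_, hnodup,
    ?_⟩, hm1⟩
  · have hx₀ : x 0 < 1 := hx 0 hm1
    simpa only [Nat.lt_one_iff, show 0 < m from hm1, if_true] using hx₀
  · intro k hk
    simpa only [hk, if_true] using hx k hk
  · intro k hk
    split_ifs with hk'
    · by_contra! hlt'
      exact (hy (k + 1) hk').not_ge ((hbridge (k + 1) hk').le_greedyEnd_succ hlt' (hyn _))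
    · exact (hlt k hk).2.le
  · intro k hk
    simpa only [hk, if_true] using hbridge k hk
  · intro j k hjk hk w hwj hwk
    obtain ⟨q, hq⟩ := (hbridge j (by lia)).exists_of_mem (hbridge k hk) hwj hwk
    have hle := hq.le_greedyEnd_succ (hx j (by lia)) (hyn k)
    have hmono : greedyEnd G v n (j + 1) ≤ greedyEnd G v n k := by
      refine Nat.le_induction (P := fun k _ ↦ k < m → _ ≤ greedyEnd G v n k) (fun _ ↦ le_rfl)
        (fun i _ ih hi ↦ ?_) k hjk hk
      exact (ih (by lia)).trans (hy i (by lia)).le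
    exact (hy k hk).not_ge (hle.trans hmono)

end GreedyVine

section EndDegrees

variable {V : Type*} {G : SimpleGraph V} {v : ℕ → V} {n : ℕ}

theorem degree_le_card_of_forall_adj {w : V} [Fintype (G.neighborSet w)] {I : Finset ℕ}
    (h : ∀ z, G.Adj w z → ∃ i ∈ I, v i = z) : G.degree w ≤ I.card := by
  classical
  refine (Finset.card_le_card (t := I.image v) fun z hz ↦ ?_).trans Finset.card_image_le
  exact Finset.mem_image.2 (h z ((G.mem_neighborFinset w z).1 hz))

theorem IsBridge.eq_nil_of_forall_adj_left {a : ℕ} {q : List V} {z : V}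
    (h : IsBridge G v n a q z) (ha : ∀ w, G.Adj (v a) w → ∃ i ≤ n, v i = w) : q = [] := by
  obtain _ | ⟨w, q⟩ := q
  · rfl
  · obtain ⟨i, hi, rfl⟩ := ha w (List.isChain_cons_cons.1 h.isChain).1
    exact (h.notMem i hi List.mem_cons_self).elim

theorem IsBridge.eq_nil_of_forall_adj_right {a : ℕ} {q : List V} {z : V}
    (h : IsBridge G v n a q z) (hz : ∀ w, G.Adj z w → ∃ i ≤ n, v i = w) : q = [] := by
  rcases List.eq_nil_or_concat' q with hq | ⟨q, w, rfl⟩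
  · exact hq
  · have hwz := h.isChain.infix (l₁ := [w, z]) ⟨v a :: q, [], by simp⟩
    obtain ⟨i, hi, rfl⟩ := hz w (List.isChain_pair.1 hwz).symm
    exact (h.notMem i hi (by simp)).elim

theorem IsBridge.adj {a : ℕ} {z : V} (h : IsBridge G v n a [] z) : G.Adj (v a) z :=
  List.isChain_pair.1 h.isChain

namespace IsVine

open Function

variable {m : ℕ} {x y : ℕ → ℕ} {Q : ℕ → List V}

theorem update_y_one (h : IsVine G v n (m + 2) x y Q) (hQ : Q 0 = []) {b : ℕ} (hxb : x 1 < b)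
    (hby : b ≤ y 1) (hb : G.Adj (v 0) (v b)) : IsVine G v n (m + 2) x (update y 1 b) Q := by
  have hy_le k : update y 1 b k ≤ y k := by
    rcases eq_or_ne k 1 with rfl | hk <;> simp [*]
  refine ⟨h.toIsPathSeq, h.x_zero, ?_, h.x_last, ?_, fun k hk ↦ ?_,
    fun k hk ↦ (hy_le k).trans (h.y_le_x_succ k hk), fun k hk ↦ ?_, fun k hk ↦ ?_, h.nodup,
    h.disjoint⟩
  · rw [update_of_ne zero_ne_one, h.y_zero]
  · rw [update_of_ne (by lia), h.y_last]
  · rcases eq_or_ne k 1 with rfl | hk1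
    · rwa [update_self]
    · rw [update_of_ne hk1]
      exact h.x_lt_y k hk
  · rcases eq_or_ne k 0 with rfl | hk0
    · rw [update_of_ne zero_ne_one, update_self]
      exact (h.y_le_x_succ 0 hk).trans_lt hxb
    · rw [update_of_ne (a := k + 1) (by lia)]
      exact (hy_le k).trans_lt (h.y_lt_y_succ k hk)
  · rcases eq_or_ne k 0 with rfl | hk0
    · rw [h.x_zero, hQ, update_self]
      exact .of_adj hb
    · rw [update_of_ne (by lia)]
      exact h.isBridge k hk

theorem update_x_last (h : IsVine G v n (m + 2) x y Q) (hQ : Q (m + 1) = []) {a : ℕ}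
    (hxa : x (m + 1) ≤ a) (hay : a < y (m + 1)) (ha : G.Adj (v n) (v a)) :
    IsVine G v n (m + 2) (update x (m + 1) a) y Q := by
  have hx_le k : x k ≤ update x (m + 1) a k := by
    rcases eq_or_ne k (m + 1) with rfl | hk <;> simp [*]
  refine ⟨h.toIsPathSeq, ?_, h.y_zero, ?_, h.y_last, fun k hk ↦ ?_,
    fun k hk ↦ (h.y_le_x_succ k hk).trans (hx_le _), h.y_lt_y_succ, fun k hk ↦ ?_, h.nodup,
    h.disjoint⟩
  · rw [update_of_ne (by lia), h.x_zero]
  · rw [update_of_ne (by lia), h.x_last]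
  · rcases eq_or_ne k (m + 1) with rfl | hkm
    · rwa [update_self]
    · rw [update_of_ne hkm]
      exact h.x_lt_y k hk
  · rcases eq_or_ne k (m + 1) with rfl | hkm
    · rw [hQ, update_self, h.y_last]
      exact .of_adj ha.symm
    · rw [update_of_ne hkm]
      exact h.isBridge k hk

theorem exists_degree_zero_le [Fintype (G.neighborSet (v 0))] (h : IsVine G v n (m + 2) x y Q)
    (hfirst : ∀ z, G.Adj (v 0) z → ∃ i ≤ n, v i = z)
    (hmax : ∀ b ≤ n, G.Adj (v 0) (v b) → b ≤ y 1) :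
    ∃ y', IsVine G v n (m + 2) x y' Q ∧ (∀ k ≠ 1, y' k = y k) ∧ y' 1 ≤ y 1 ∧
      G.degree (v 0) ≤ x 1 + (y 1 + 1 - y' 1) := by
  classical
  have hbridge := h.isBridge 0 (by lia)
  rw [h.x_zero] at hbridge
  have hQ := hbridge.eq_nil_of_forall_adj_left hfirst
  rw [hQ] at hbridge
  have hex : ∃ b, x 1 < b ∧ G.Adj (v 0) (v b) := ⟨y 1, h.x_lt_y 1 (by lia), hbridge.adj⟩
  obtain ⟨hxb, hb⟩ := Nat.find_spec hex
  have hby := Nat.find_min' hex ⟨h.x_lt_y 1 (by lia), hbridge.adj⟩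
  refine ⟨_, h.update_y_one hQ hxb hby hb, fun k hk ↦ update_of_ne hk _ _, ?_⟩
  rw [update_self]
  refine ⟨hby, ?_⟩
  have hdeg : G.degree (v 0) ≤ (Finset.Icc 1 (x 1) ∪ Finset.Icc (Nat.find hex) (y 1)).card := by
    refine degree_le_card_of_forall_adj (v := v) fun z hz ↦ ?_
    obtain ⟨i, hi, rfl⟩ := hfirst z hz
    refine ⟨i, ?_, rfl⟩
    rw [Finset.mem_union, Finset.mem_Icc, Finset.mem_Icc]
    rcases le_or_gt i (x 1) with hle | hlt
    · exact .inl ⟨Nat.pos_of_ne_zero fun h0 ↦ hz.ne (h0 ▸ rfl), hle⟩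
    · exact .inr ⟨Nat.find_min' hex ⟨hlt, hz⟩, hmax i hi hz⟩
  simpa using hdeg.trans (Finset.card_union_le _ _)

theorem exists_degree_last_le [Fintype (G.neighborSet (v n))] (h : IsVine G v n (m + 2) x y Q)
    (hlast : ∀ z, G.Adj (v n) z → ∃ i ≤ n, v i = z)
    (hmin : ∀ a, G.Adj (v n) (v a) → y m ≤ a) :
    ∃ x', IsVine G v n (m + 2) x' y Q ∧ (∀ k ≠ m + 1, x' k = x k) ∧
      G.degree (v n) ≤ (x' (m + 1) + 1 - y m) + (n - y (m + 1)) := by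
  classical
  have hxy := h.x_lt_y (m + 1) (by lia)
  have hbridge := h.isBridge (m + 1) (by lia)
  rw [h.y_last] at hbridge
  have hQ := hbridge.eq_nil_of_forall_adj_right hlast
  rw [hQ] at hbridge
  let P i := i < y (m + 1) ∧ G.Adj (v n) (v i)
  have hyn := h.y_le (i := m + 1) (by lia)
  have hle {i : ℕ} (hi : P i) : i ≤ Nat.findGreatest P n :=
    Nat.le_findGreatest (hi.1.le.trans hyn) hi
  have hx : P (x (m + 1)) := ⟨hxy, hbridge.adj.symm⟩
  obtain ⟨hay, ha⟩ : P (Nat.findGreatest P n) := Nat.findGreatest_spec (hxy.le.trans hyn) hx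
  refine ⟨_, h.update_x_last hQ (hle hx) hay ha, fun k hk ↦ update_of_ne hk _ _, ?_⟩
  rw [update_self]
  have hdeg : G.degree (v n) ≤
      (Finset.Icc (y m) (Nat.findGreatest P n) ∪ Finset.Ico (y (m + 1)) n).card := by
    refine degree_le_card_of_forall_adj (v := v) fun z hz ↦ ?_
    obtain ⟨i, hi, rfl⟩ := hlast z hz
    refine ⟨i, ?_, rfl⟩
    rw [Finset.mem_union, Finset.mem_Icc, Finset.mem_Ico]
    rcases lt_or_ge i (y (m + 1)) with hlt | hge
    · exact .inl ⟨hmin i hz, hle ⟨hlt, hz⟩⟩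
    · exact .inr ⟨hge, hi.lt_of_ne fun hin ↦ hz.ne (hin ▸ rfl)⟩
  simpa using hdeg.trans (Finset.card_union_le _ _)

theorem degree_add_degree_add_le_circumference [Finite V] [Fintype (G.neighborSet (v 0))]
    [Fintype (G.neighborSet (v n))] (h : IsVine G v n (m + 3) x y Q)
    (hfirst : ∀ z, G.Adj (v 0) z → ∃ i ≤ n, v i = z)
    (hlast : ∀ z, G.Adj (v n) z → ∃ i ≤ n, v i = z)
    (hmax : ∀ b ≤ n, G.Adj (v 0) (v b) → b ≤ y 1)
    (hmin : ∀ a, G.Adj (v n) (v a) → y (m + 1) ≤ a) :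
    G.degree (v 0) + G.degree (v n) + (m + 3) ≤ G.circumference + 2 := by
  obtain ⟨x', hvine, hx', hdegn⟩ := h.exists_degree_last_le hlast hmin
  obtain ⟨y', hvine', hy', hy₁, hdeg0⟩ := hvine.exists_degree_zero_le hfirst hmax
  have hall := hvine'.add_le_circumference (i := 0) (by lia) le_rfl
  rw [hvine'.x_zero, hvine'.y_zero, Finset.sum_Ico_succ_top (by lia),
    Finset.sum_Ico_succ_top (by lia), Finset.sum_eq_sum_Ico_succ_bot (by lia), hvine'.x_last,
    hvine'.y_zero, hy' (m + 1 + 1) (by lia)] at hall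
  have hyx₀ := hvine'.y_le_x_succ 0 (by lia)
  have hyx₁ := h.y_le_x_succ 1 (by lia)
  have hyx := hvine.y_le_x_succ (m + 1) (by lia)
  rw [hvine'.y_zero] at hyx₀
  have hinner : y 1 - y' 1 + (x' (m + 2) - y (m + 1)) ≤
      ∑ k ∈ Finset.Ico 1 (m + 1), (x' (k + 1) - y' k) + (x' (m + 2) - y' (m + 1)) := by
    obtain _ | m := m
    · lia
    · have := Finset.single_le_sum (fun _ _ ↦ Nat.zero_le _) (f := fun k ↦ x' (k + 1) - y' k)
        (Finset.mem_Ico.2 (⟨le_rfl, by lia⟩ : 1 ≤ 1 ∧ 1 < m + 1 + 1))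
      have := hx' 2 (by lia)
      have := hy' (m + 2) (by lia)
      lia
  lia

end IsVine

end EndDegrees

section LongestPath

variable {V : Type*} {G : SimpleGraph V} {n : ℕ}

theorem IsPathList.exists_isPathSeq [Nonempty V] {l : List V} (hl : IsPathList G l)
    (hlen : l.length = n + 1) : ∃ v, IsPathSeq G v n ∧ l = (List.range (n + 1)).map v := by
  have hv i (hi : i < l.length) : l.getD i (Classical.arbitrary V) = l[i] :=
    List.getD_eq_getElem _ _ hi
  refine ⟨fun i ↦ l.getD i (Classical.arbitrary V), ⟨fun i hi j hj hij ↦ ?_, fun i hi ↦ ?_⟩, ?_⟩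
  · rw [Set.mem_Iic] at hi hj
    rwa [hv i (by lia), hv j (by lia), hl.nodup.getElem_inj_iff] at hij
  · rw [hv i (by lia), hv (i + 1) (by lia)]
    exact List.isChain_iff_getElem.1 hl.isChain i (by lia)
  · refine List.ext_getElem (by simpa using hlen) fun i hi _ ↦ ?_
    rw [List.getElem_map, List.getElem_range, hv i hi]

theorem exists_isPathSeq_of_longestPathOrder_eq [Finite V] [Nonempty V]
    (hn : G.longestPathOrder = n + 1) :
    ∃ v, IsPathSeq G v n ∧ (∀ z, G.Adj (v 0) z → ∃ i ≤ n, v i = z) ∧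
      ∀ z, G.Adj (v n) z → ∃ i ≤ n, v i = z := by
  obtain ⟨l, hl, hlen⟩ := exists_isPathList_length_eq (G := G)
  obtain ⟨v, hv, rfl⟩ := hl.exists_isPathSeq (hlen.trans hn)
  have hmax l' (hl' : IsPathList G l') : l'.length ≤ n + 1 :=
    hn ▸ hl'.length_le_longestPathOrder
  refine ⟨v, hv, fun z hz ↦ ?_, fun z hz ↦ ?_⟩
  · rw [List.range_succ_eq_map, List.map_cons] at hl
    have hmem := hl.mem_of_adj_head (by simpa using hmax) hz
    simp only [List.mem_map, List.mem_range, exists_exists_and_eq_and] at hmem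
    obtain ⟨i, hi, rfl⟩ := hmem
    exact ⟨i + 1, hi, rfl⟩
  · have hrev := hl.reverse
    rw [List.range_succ, List.map_append, List.reverse_append, List.map_singleton,
      List.reverse_singleton, List.singleton_append] at hrev
    have hmem := hrev.mem_of_adj_head (by simpa using hmax) hz
    simp only [List.mem_reverse, List.mem_map, List.mem_range] at hmem
    obtain ⟨i, hi, rfl⟩ := hmem
    exact ⟨i, hi.le, rfl⟩

theorem exists_isVine_of_longestPathOrder_eq [G.LocallyFinite] (hG : G.IsVertexConnected 2)
    {δ : ℕ} (hδ : ∀ v, δ ≤ G.degree v) (hn : G.longestPathOrder = n + 1) :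
    ∃ v m x y Q, IsVine G v n m x y Q ∧ 1 ≤ m ∧ (3 ≤ m → 2 * δ + m ≤ G.circumference + 2) := by
  obtain ⟨_, _⟩ := Nat.card_pos_iff.1 (Nat.zero_lt_of_lt hG.1)
  have hp := three_le_longestPathOrder hG
  obtain ⟨v, hv, hfirst, hlast⟩ := exists_isPathSeq_of_longestPathOrder_eq hn
  obtain ⟨m, x, Q, h, hm⟩ := hv.exists_isVine_greedyEnd hG (by lia)
  refine ⟨v, m, x, _, Q, h, hm, fun hm₃ ↦ ?_⟩
  obtain ⟨m, rfl⟩ := Nat.exists_eq_add_of_le' hm₃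
  have hdeg := h.degree_add_degree_add_le_circumference hfirst hlast
    (fun b hb ↦ le_greedyEnd_one hb) (fun a ↦ h.greedyEnd_le_of_adj)
  have hδ₀ := hδ (v 0)
  have hδₙ := hδ (v n)
  lia

theorem two_mul_add_le_of_four_mul_add_sq_le {p c δ t : ℕ} (hδ : 2 ≤ δ) (ht : t + 2 * δ ≤ c + 3)
    (hp : 4 * p + t ^ 2 ≤ 2 * t * c + 5) : 2 * p + c * (2 * δ + 1) + 2 ≤ c ^ 2 + 8 * δ := by
  zify at *
  have hsq : (2 * δ - 3 : ℤ) ^ 2 ≤ (c - t) ^ 2 := pow_le_pow_left₀ (by lia) (by lia) 2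
  have hp' : 4 * (p : ℤ) ≤ 2 * (c * (c - 1)) - 4 * (c * δ) + 16 * δ - 3 := by
    nlinarith [sq_nonneg (c - 2 * δ - 1 : ℤ)]
  obtain ⟨k, hk⟩ := Int.even_mul_pred_self c
  have hp'' : (p : ℤ) ≤ k - c * δ + 4 * δ - 1 := by lia
  linarith

theorem two_mul_longestPathOrder_add_le [G.LocallyFinite] (hG : G.IsVertexConnected 2) {δ : ℕ}
    (hδ : ∀ v, δ ≤ G.degree v) (hδ₂ : 2 ≤ δ) (hp : 3 * δ ≤ G.longestPathOrder + 1) :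
    2 * G.longestPathOrder + G.circumference * (2 * δ + 1) + 2 ≤
      G.circumference ^ 2 + 8 * δ := by
  obtain ⟨_, _⟩ := Nat.card_pos_iff.1 (Nat.zero_lt_of_lt hG.1)
  have hc : 2 * δ ≤ G.circumference := by
    have hdirac := natCard_le_circumference_or_two_mul_le hG hδ
    have hcard := longestPathOrder_le_natCard (G := G)
    lia
  obtain ⟨n, hn⟩ := Nat.exists_eq_add_of_le' (show 1 ≤ G.longestPathOrder by lia)
  obtain ⟨v, m, x, y, Q, h, hm, hmc⟩ := exists_isVine_of_longestPathOrder_eq hG hδ hn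
  rw [hn]
  exact two_mul_add_le_of_four_mul_add_sq_le hδ₂ (t := m + 1) (by lia)
    (h.four_mul_length_add_sq_le hm)

end LongestPath

section RealBounds

theorem sqrt_two_mul_lt_self {p : ℝ} (hp : 2 < p) : √(2 * p) < p := by
  rw [Real.sqrt_lt' (by linarith)]
  nlinarith

theorem sqrt_two_mul_lt_sub_one {p : ℝ} (hp : 4 ≤ p) : √(2 * p) < p - 1 := by
  rw [Real.sqrt_lt' (by linarith)]
  nlinarith

theorem sqrt_add_le_of_two_mul_add_le {p c δ : ℝ} (hc : δ + 1 / 2 ≤ c)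
    (h : 2 * p + c * (2 * δ + 1) + 2 ≤ c ^ 2 + 8 * δ) :
    √(2 * p - 10 + (δ - 7 / 2) ^ 2) + δ + 1 / 2 ≤ c := by
  rw [add_assoc, ← le_sub_iff_add_le, Real.sqrt_le_left (by linarith)]
  linarith

theorem sqrt_two_mul_lt_sqrt_add {p δ : ℝ} (hδ : 2 ≤ δ) (hp : 3 * δ ≤ p + 1) :
    √(2 * p) < √(2 * p - 10 + (δ - 7 / 2) ^ 2) + δ + 1 / 2 := by
  have hge : (3 / 2) ^ 2 ≤ 2 * p - 10 + (δ - 7 / 2) ^ 2 := by nlinarith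
  have hsq := Real.sq_sqrt ((sq_nonneg _).trans hge)
  have hsqrt := Real.le_sqrt_of_sq_le hge
  rw [Real.sqrt_lt' (by linarith)]
  nlinarith [mul_nonneg (sub_nonneg.2 hδ) (sub_nonneg.2 hsqrt)]

end RealBounds

end CircumferenceBound

theorem theorem1 {V : Type*} [Fintype V] (G : SimpleGraph V) [DecidableRel G.Adj]
    (hG : G.IsVertexConnected 2) (c p δ : ℕ)
    (hc : c = G.circumference) (hp : p = G.longestPathOrder) (hδ : δ = G.minDegree) :
    -- the lower bound on the circumference
    ((p ≤ 2 * δ → p ≤ c) ∧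
      (2 * δ + 1 ≤ p ∧ (p : ℤ) ≤ 3 * (δ : ℤ) - 2 → (p : ℤ) - 1 ≤ (c : ℤ)) ∧
      ((p : ℤ) ≥ 3 * (δ : ℤ) - 1 →
        √(2 * (p : ℝ) - 10 + ((δ : ℝ) - 7 / 2) ^ 2) + (δ : ℝ) + 1 / 2 ≤ (c : ℝ))) ∧
    -- it yields the degree bound for the circumference
    min (Fintype.card V) (2 * δ) ≤ c ∧
    -- and in each of the three ranges it is strictly larger than `√(2p)`
    ((p ≤ 2 * δ → √(2 * (p : ℝ)) < (p : ℝ)) ∧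
      (2 * δ + 1 ≤ p ∧ (p : ℤ) ≤ 3 * (δ : ℤ) - 2 → √(2 * (p : ℝ)) < (p : ℝ) - 1) ∧
      ((p : ℤ) ≥ 3 * (δ : ℤ) - 1 →
        √(2 * (p : ℝ)) < √(2 * (p : ℝ) - 10 + ((δ : ℝ) - 7 / 2) ^ 2) + (δ : ℝ) + 1 / 2)) := by
  subst hc hp hδ
  obtain ⟨_, _⟩ := Nat.card_pos_iff.1 (Nat.zero_lt_of_lt hG.1)
  have hδ₂ := G.le_minDegree_of_forall_le_degree 2
    fun v ↦ CircumferenceBound.two_le_degree_of_isVertexConnected hG v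
  have hp₃ := CircumferenceBound.three_le_longestPathOrder hG
  have hpn := CircumferenceBound.longestPathOrder_le_natCard (G := G)
  have hdirac :=
    CircumferenceBound.natCard_le_circumference_or_two_mul_le hG G.minDegree_le_degree
  have hnear := CircumferenceBound.longestPathOrder_le_circumference_add_one_or_three_mul_le hG
    G.minDegree_le_degree
  rw [← Nat.card_eq_fintype_card]
  refine ⟨⟨fun _ ↦ by lia, fun _ ↦ by lia, fun hp ↦ ?_⟩, by lia, fun _ ↦ ?_, fun hp ↦ ?_,
    fun hp ↦ ?_⟩
  · have hquadratic := CircumferenceBound.two_mul_longestPathOrder_add_le hG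
      G.minDegree_le_degree hδ₂ (by lia)
    have hc : G.minDegree + 1 ≤ G.circumference := by lia
    rify at hc hquadratic
    exact CircumferenceBound.sqrt_add_le_of_two_mul_add_le (by linarith) hquadratic
  · exact CircumferenceBound.sqrt_two_mul_lt_self (by exact_mod_cast hp₃)
  · exact CircumferenceBound.sqrt_two_mul_lt_sub_one (by exact_mod_cast (by lia : 4 ≤ _))
  · refine CircumferenceBound.sqrt_two_mul_lt_sqrt_add (by exact_mod_cast hδ₂) ?_
    exact_mod_cast (by lia : 3 * G.minDegree ≤ G.longestPathOrder + 1)
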